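/- **Setting.** Let $R_0$ be an irreducible reduced crystallographic root system spanning a real finite-dimensional vector space $V$ with a Weyl-group-invariant inner product $\langle\cdot,\cdot\rangle$; put $\alpha^\vee=2\alpha/\langle\alpha,\alpha\rangle$. Fix simple roots $\alpha_1,\dots,\alpha_n$ with positive roots $R_0^+$, let $\vartheta$ be the highest short root (all roots are short in the simply-laced case), let $Q=\mathrm{Span}_{\mathbb Z}R_0$ and $P=\{\lambda\in V\mid\langle\lambda,\alpha^\vee\rangle\in\mathbb Z\ \forall\alpha\in R_0\}$, and fix an integer $c>1$. The affine roots are the functions $a=\alpha^\vee+rc$, $a(x)=\langle x,\alpha^\vee\rangle+rc$ ($\alpha\in R_0$, $r\in\mathbb Z$); $s_a(x)=x-a(x)\alpha$. The set $R^+$ of positive affine roots consists of the $\alpha^\vee$ ($\alpha\in R_0^+$) and the $\alpha^\vee+rc$ ($\alpha\in R_0$, $r\ge1$), and $R^-=-R^+$. The simple affine roots are $a_0=-\vartheta^\vee+c$ and $a_j=\alpha_j^\vee$ ($1\le j\le n$), and $s_j=s_{a_j}$. Let $W_0$ be the finite Weyl group, $W_R=\langle s_a\rangle=W_0\ltimes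 t(cQ)$ the affine Weyl group, and $W=W_0\ltimes t(cP)$ the extended affine Weyl group, where $t_y(x)=x+y$. The group $W$ acts on functions by $(wf)(x)=f(w^{-1}x)$. Put $\ell(w)=\#\{a\in R^+\mid wa\in R^-\}$ and $\Omega=\{u\in W\mid\ell(u)=0\}$. Let $\tau:W\to\mathbb R\setminus\{0\}$ be length multiplicative: $\tau_{ww'}=\tau_w\tau_{w'}$ if $\ell(ww')=\ell(w)+\ell(w')$, and $\tau_w=1$ if $\ell(w)=0$. Write $\tau_j=\tau_{s_j}$ and assume $0<\tau_j^2<1$ for $j=0,\dots,n$. The extended affine Hecke algebra $H$ is the complex unital associative algebra generated by $T_w$ ($w\in W$) with relations $T_1=1$, $T_wT_{w'}=T_{ww'}$ if $\ell(ww')=\ell(w)+\ell(w')$, and $(T_j-\tau_j)(T_j+\tau_j^{-1})=0$ for $T_j=T_{s_j}$, $0\le j\le n$. It carries the antilinear anti-multiplicative involution $*$ with $T_w^*=T_{w^{-1}}$. On the space $\mathcal C(P)$ of functions $f:P\to\mathbb C$ let $\hat T_j=\tau_j+\chi_j\,(s_j-1)$, where $\chi_j$ is multiplication by the function equal to $\tau_j$,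 $1$, $\tau_j^{-1}$ at $\lambda$ according as $a_j(\lambda)>0$, $=0$, $<0$. The *difference-reflection representation* is the algebra homomorphism $\hat T:H\to\mathrm{End}(\mathcal C(P))$ with $\hat T(T_j)=\hat T_j$ ($0\le j\le n$) and $\hat T(T_u)=u$ ($u\in\Omega$). For $\lambda\in P$ let $w_\lambda$ be the unique shortest element of $W_R$ with $w_\lambda\lambda\in A_c=\{x\in V\mid a(x)\ge0\ \forall a\in R^+\}$, and let $$\delta_\lambda=W_R(\tau^2)^{-1}\tau_{w_\lambda}^2,\qquad W_R(\tau^2)=\sum_{w\in W_R}\tau_w^2,\qquad \langle f,g\rangle_\delta=\sum_{\lambda\in P}f(\lambda)\overline{g(\lambda)}\,\delta_\lambda,$$ $l^2(P,\delta)=\{f\in\mathcal C(P)\mid\langle f,f\rangle_\delta<\infty\}$, $\|f\|_\delta=\langle f,f\rangle_\delta^{1/2}$. **Proposition 8.1.** The series $W_R(\tau^2)$ converges and $\delta_\lambda>0$ for all $\lambda\in P$. The difference-reflection representation $\hat T$ of $H$ on $\mathcal C(P)$ exists and is unique, and it restricts to a unitary representation of $H$ by bounded operators on $l^2(P,\delta)$: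 for every $h\in H$ there is a constant $C$ such that $\hat T(h)f\in l^2(P,\delta)$ and $\|\hat T(h)f\|_\delta\le C\|f\|_\delta$ for all $f\in l^2(P,\delta)$, and $$\langle\hat T(h)f,g\rangle_\delta=\langle f,\hat T(h^*)g\rangle_\delta\qquad(h\in H,\ f,g\in l^2(P,\delta)).$$ -/

import Mathlib

open scoped ComplexConjugate

namespace CriticalHecke

noncomputable section

/-! Affine roots, the affine Weyl group and the extended affine Weyl group.

Throughout `P : RootPairing ι ℝ V N` is the finite root system `R₀ = {α_i}` in `V`, with coroots
`α_i^∨` (seen as linear functionals on `V`), `b` is a base (a choice of positive roots), `ϑ` is the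
index of the highest short root and `c` is the integral scale parameter. -/

section Geometry

variable {ι V N : Type*} [AddCommGroup V] [Module ℝ V] [AddCommGroup N] [Module ℝ N]

/-- The affine root `a = α_i^∨ + r c`, i.e. the function `a(x) = ⟨x, α_i^∨⟩ + r c` on `V`. -/
def affRoot (P : RootPairing ι ℝ V N) (c : ℕ) (i : ι) (r : ℤ) : V → ℝ :=
  fun x => P.coroot' i x + (r : ℝ) * c

/-- The translation `t_y : x ↦ x + y`. -/
def translation (y : V) : V ≃ᵃ[ℝ] V := AffineEquiv.constVAdd ℝ V y

/-- The affine reflection `s_a : x ↦ x - a(x) α_i` for `a = α_i^∨ + r c`, as the composite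
`t_{-r c α_i} ∘ s_{α_i}`. -/
def affRefl (P : RootPairing ι ℝ V N) (c : ℕ) (i : ι) (r : ℤ) : V ≃ᵃ[ℝ] V :=
  translation (-(((r : ℝ) * c) • P.root i)) * (P.reflection i).toAffineEquiv

theorem affRefl_apply (P : RootPairing ι ℝ V N) (c : ℕ) (i : ι) (r : ℤ) (x : V) :
    affRefl P c i r x = x - affRoot P c i r x • P.root i := by
  simp only [affRefl, translation, affRoot, AffineEquiv.mul_def, AffineEquiv.trans_apply,
    LinearEquiv.coe_toAffineEquiv, AffineEquiv.constVAdd_apply, vadd_eq_add,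
    RootPairing.reflection_apply, add_smul]
  abel

/-- The weight lattice `{λ ∈ V | ⟨λ, α^∨⟩ ∈ ℤ for all α ∈ R₀}`. -/
def weightLattice (P : RootPairing ι ℝ V N) : AddSubgroup V where
  carrier := {x | ∀ i, ∃ n : ℤ, P.coroot' i x = n}
  zero_mem' := fun i => ⟨0, by simp⟩
  add_mem' := fun {x y} hx hy i => by
    obtain ⟨m, hm⟩ := hx i
    obtain ⟨n, hn⟩ := hy i
    exact ⟨m + n, by rw [map_add, hm, hn, Int.cast_add]⟩
  neg_mem' := fun {x} hx i => by
    obtain ⟨m, hm⟩ := hx i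
    exact ⟨-m, by rw [map_neg, hm, Int.cast_neg]⟩

theorem root_mem_weightLattice (P : RootPairing ι ℝ V N) [P.IsCrystallographic] (i : ι) :
    P.root i ∈ weightLattice P := fun j => by
  obtain ⟨n, hn⟩ := P.exists_value (S := ℤ) i j
  exact ⟨n, by simpa using hn.symm⟩

/-- The extended affine Weyl group `W = W₀ ⋉ t(cP)`: the group of affine transformations of `V`
generated by the finite Weyl group and the translations over `c` times the weight lattice. -/
def extAffineWeyl (P : RootPairing ι ℝ V N) (c : ℕ) : Subgroup (V ≃ᵃ[ℝ] V) :=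
  Subgroup.closure (Set.range (fun i => (P.reflection i).toAffineEquiv) ∪
    {g | ∃ x ∈ weightLattice P, g = translation ((c : ℝ) • x)})

/-- The affine Weyl group `W_R`, generated by the reflections `s_a` in the affine roots `a`. -/
def affineWeyl (P : RootPairing ι ℝ V N) (c : ℕ) : Subgroup (V ≃ᵃ[ℝ] V) :=
  Subgroup.closure {g | ∃ i r, g = affRefl P c i r}

theorem affRefl_mem (P : RootPairing ι ℝ V N) [P.IsCrystallographic] (c : ℕ) (i : ι) (r : ℤ) :
    affRefl P c i r ∈ extAffineWeyl P c := by
  refine Subgroup.mul_mem _ (Subgroup.subset_closure (Or.inr ⟨(-r) • P.root i,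
    AddSubgroup.zsmul_mem _ (root_mem_weightLattice P i) _, ?_⟩))
    (Subgroup.subset_closure (Or.inl ⟨i, rfl⟩))
  congr 1
  rw [← Int.cast_smul_eq_zsmul ℝ, smul_smul, ← neg_smul]
  congr 1
  push_cast
  ring

/-- The affine reflection `s_a` as an element of `W`. -/
def reflW (P : RootPairing ι ℝ V N) [P.IsCrystallographic] (c : ℕ) (i : ι) (r : ℤ) :
    extAffineWeyl P c := ⟨affRefl P c i r, affRefl_mem P c i r⟩

/-- `W` preserves the weight lattice, as `c` is an integer. -/
theorem apply_mem_weightLattice (P : RootPairing ι ℝ V N) [P.IsCrystallographic] {c : ℕ}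
    {w : V ≃ᵃ[ℝ] V} (hw : w ∈ extAffineWeyl P c) :
    ∀ x ∈ weightLattice P, w x ∈ weightLattice P := by
  have hrefl : ∀ i, ∀ x ∈ weightLattice P, P.reflection i x ∈ weightLattice P := by
    intro i x hx
    obtain ⟨n, hn⟩ := hx i
    rw [RootPairing.reflection_apply, hn, Int.cast_smul_eq_zsmul]
    exact sub_mem hx (AddSubgroup.zsmul_mem _ (root_mem_weightLattice P i) _)
  have htr : ∀ y ∈ weightLattice P, ∀ x ∈ weightLattice P,
      translation ((c : ℝ) • y) x ∈ weightLattice P := by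
    intro y hy x hx
    simp only [translation, AffineEquiv.constVAdd_apply, vadd_eq_add, Nat.cast_smul_eq_nsmul]
    exact add_mem (nsmul_mem hy c) hx
  unfold extAffineWeyl at hw
  induction hw using Subgroup.closure_induction'' with
  | one => intro x hx; exact hx
  | mem g hg =>
    rcases hg with ⟨i, rfl⟩ | ⟨y, hy, rfl⟩
    · exact hrefl i
    · exact htr y hy
  | inv_mem g hg =>
    rcases hg with ⟨i, rfl⟩ | ⟨y, hy, rfl⟩
    · intro x hx
      have : ((P.reflection i).toAffineEquiv)⁻¹ x = P.reflection i x := by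
        change (P.reflection i).symm x = _
        rw [LinearEquiv.symm_apply_eq, RootPairing.reflection_same]
      rw [this]
      exact hrefl i x hx
    · intro x hx
      have : (translation ((c : ℝ) • y))⁻¹ x = translation ((c : ℝ) • (-y)) x := by
        change (AffineEquiv.constVAdd ℝ V ((c : ℝ) • y)).symm x = _
        simp [translation]
      rw [this]
      exact htr _ (neg_mem hy) x hx
  | mul g h _ _ hg hh => intro x hx; exact hg _ (hh x hx)

/-- The action of `W` on the weight lattice. -/
instance (P : RootPairing ι ℝ V N) [P.IsCrystallographic] (c : ℕ) :
    MulAction (extAffineWeyl P c) (weightLattice P) where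
  smul w x := ⟨(w : V ≃ᵃ[ℝ] V) x, apply_mem_weightLattice P w.2 x x.2⟩
  one_smul _ := rfl
  mul_smul _ _ _ := rfl

/-- The positive affine roots `R⁺ = R₀^{∨,+} ∪ (R₀^∨ + ℕ c)` with `ℕ = {1, 2, …}`. -/
def posAffRoots {P : RootPairing ι ℝ V N} (b : P.Base) (c : ℕ) : Set (V → ℝ) :=
  {a | (∃ i, b.IsPos i ∧ a = affRoot P c i 0) ∨ (∃ i, ∃ r : ℤ, 1 ≤ r ∧ a = affRoot P c i r)}

/-- `R(w) = R⁺ ∩ w⁻¹(R⁻)` with `R⁻ = -R⁺`, where `w` acts on functions by `(wa)(x) = a(w⁻¹x)`. -/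
def inversions {P : RootPairing ι ℝ V N} (b : P.Base) (c : ℕ) (w : V ≃ᵃ[ℝ] V) : Set (V → ℝ) :=
  {a | a ∈ posAffRoots b c ∧ -(a ∘ w.symm) ∈ posAffRoots b c}

/-- The length `ℓ(w) = #R(w)`. -/
def length {P : RootPairing ι ℝ V N} (b : P.Base) (c : ℕ) (w : V ≃ᵃ[ℝ] V) : ℕ :=
  (inversions b c w).ncard

theorem length_inv {P : RootPairing ι ℝ V N} (b : P.Base) (c : ℕ) (w : V ≃ᵃ[ℝ] V) :
    length b c w⁻¹ = length b c w := by
  have h : inversions b c w⁻¹ = (fun a : V → ℝ => -(a ∘ w.symm)) '' inversions b c w := by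
    ext a
    constructor
    · rintro ⟨h1, h2⟩
      change -(a ∘ w) ∈ _ at h2
      refine ⟨-(a ∘ w), ⟨h2, ?_⟩, ?_⟩
      · convert h1 using 1
        ext x
        simp
      · ext x
        simp
    · rintro ⟨a, ⟨h1, h2⟩, rfl⟩
      refine ⟨h2, ?_⟩
      change -((-(a ∘ w.symm)) ∘ w) ∈ _
      convert h1 using 1
      ext x
      simp
  rw [length, length, h, Set.ncard_image_of_injective]
  intro a a' haa
  ext x
  simpa using congrFun haa (w x)

/-- The highest short root: a root of minimal length `|ϑ|` (with respect to the canonical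
Weyl-group-invariant inner product; for simply-laced systems all roots are short) such that `ϑ - β`
is a nonnegative integral combination of simple roots for every short root `β`. -/
structure IsHighestShortRoot [Fintype ι] {P : RootPairing ι ℝ V N} (b : P.Base) (ϑ : ι) : Prop where
  short : ∀ i, P.RootForm (P.root ϑ) (P.root ϑ) ≤ P.RootForm (P.root i) (P.root i)
  highest : ∀ j, (∀ i, P.RootForm (P.root j) (P.root j) ≤ P.RootForm (P.root i) (P.root i)) →
    P.root ϑ - P.root j ∈ AddSubmonoid.closure (P.root '' b.support)

/-- The simple affine roots `a_j = α_j^∨` (`j = 1, …, n`, here `some j`) and `a_0 = -ϑ^∨ + c`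
(here `none`), each given by its pair (root, multiple of `c`). The index `P.reflectionPerm ϑ ϑ`
is that of the root `s_ϑ ϑ = -ϑ`. -/
def simpleIdx {P : RootPairing ι ℝ V N} (b : P.Base) (ϑ : ι) : Option b.support → ι × ℤ
  | none => (P.reflectionPerm ϑ ϑ, 1)
  | some j => (j, 0)

/-- The function `a_j` on `V`. -/
def simpleRoot {P : RootPairing ι ℝ V N} (b : P.Base) (ϑ : ι) (c : ℕ) (j : Option b.support) :
    V → ℝ := affRoot P c (simpleIdx b ϑ j).1 (simpleIdx b ϑ j).2

/-- The simple reflection `s_j = s_{a_j}`. -/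
def simpleRefl {P : RootPairing ι ℝ V N} [P.IsCrystallographic] (b : P.Base) (ϑ : ι) (c : ℕ)
    (j : Option b.support) : extAffineWeyl P c :=
  reflW P c (simpleIdx b ϑ j).1 (simpleIdx b ϑ j).2

/-- A (real-valued) length multiplicative function `τ : W → ℝ \ {0}`. -/
structure IsLengthMultiplicative {P : RootPairing ι ℝ V N} (b : P.Base) (c : ℕ)
    (τ : extAffineWeyl P c → ℝ) : Prop where
  ne_zero : ∀ w, τ w ≠ 0
  map_mul : ∀ w w' : extAffineWeyl P c,
    length b c (w * w' : extAffineWeyl P c) = length b c w + length b c w' →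
      τ (w * w') = τ w * τ w'
  map_length_zero : ∀ w : extAffineWeyl P c, length b c w = 0 → τ w = 1

/-- The closed dominant Weyl alcove `A_c = {x ∈ V | a(x) ≥ 0 for all a ∈ R⁺}`. -/
def alcove {P : RootPairing ι ℝ V N} (b : P.Base) (c : ℕ) : Set V :=
  {x | ∀ a ∈ posAffRoots b c, 0 ≤ a x}

/-- `w` is a shortest element of `W_R` that maps `x` into the dominant alcove. -/
def IsShortestToAlcove {P : RootPairing ι ℝ V N} (b : P.Base) (c : ℕ) (x : V)
    (w : extAffineWeyl P c) : Prop :=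
  (w : V ≃ᵃ[ℝ] V) ∈ affineWeyl P c ∧ (w : V ≃ᵃ[ℝ] V) x ∈ alcove b c ∧
    ∀ v ∈ affineWeyl P c, v x ∈ alcove b c → length b c w ≤ length b c v

/-- The (unique) shortest element `w_x` of `W_R` that maps `x` into the dominant alcove. -/
def shortest {P : RootPairing ι ℝ V N} (b : P.Base) (c : ℕ) (x : V) : extAffineWeyl P c :=
  Classical.epsilon (IsShortestToAlcove b c x)

end Geometry

/-! The extended affine Hecke algebra. -/

section Hecke

variable {ι V N : Type*} [AddCommGroup V] [Module ℝ V] [AddCommGroup N] [Module ℝ N]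
  {P : RootPairing ι ℝ V N} [P.IsCrystallographic]

/-- The defining relations of the extended affine Hecke algebra, for generators `T_w`, `w ∈ W`:
`T_1 = 1`, `T_w T_{w'} = T_{w w'}` if `ℓ(w w') = ℓ(w) + ℓ(w')`, and
`(T_j - τ_j)(T_j + τ_j⁻¹) = 0` for `T_j = T_{s_j}`, `τ_j = τ_{s_j}`. -/
inductive HeckeRel (b : P.Base) (ϑ : ι) (c : ℕ) (τ : extAffineWeyl P c → ℝ) :
    FreeAlgebra ℂ (extAffineWeyl P c) → FreeAlgebra ℂ (extAffineWeyl P c) → Prop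
  | one : HeckeRel b ϑ c τ (FreeAlgebra.ι ℂ 1) 1
  | mul (w w' : extAffineWeyl P c)
      (h : length b c (w * w' : extAffineWeyl P c) = length b c w + length b c w') :
      HeckeRel b ϑ c τ (FreeAlgebra.ι ℂ w * FreeAlgebra.ι ℂ w') (FreeAlgebra.ι ℂ (w * w'))
  | quad (j : Option b.support) :
      HeckeRel b ϑ c τ
        ((FreeAlgebra.ι ℂ (simpleRefl b ϑ c j) -
            algebraMap ℂ _ (τ (simpleRefl b ϑ c j) : ℂ)) *
          (FreeAlgebra.ι ℂ (simpleRefl b ϑ c j) +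
            algebraMap ℂ _ ((τ (simpleRefl b ϑ c j) : ℂ)⁻¹))) 0

/-- The extended affine Hecke algebra `H`: the complex unital associative algebra generated by
the `T_w`, `w ∈ W`, subject to the relations `HeckeRel`. -/
def HeckeAlgebra (b : P.Base) (ϑ : ι) (c : ℕ) (τ : extAffineWeyl P c → ℝ) : Type _ :=
  RingQuot (HeckeRel b ϑ c τ)

instance (b : P.Base) (ϑ : ι) (c : ℕ) (τ : extAffineWeyl P c → ℝ) :
    Ring (HeckeAlgebra b ϑ c τ) := inferInstanceAs (Ring (RingQuot (HeckeRel b ϑ c τ)))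

instance (b : P.Base) (ϑ : ι) (c : ℕ) (τ : extAffineWeyl P c → ℝ) :
    Algebra ℂ (HeckeAlgebra b ϑ c τ) :=
  inferInstanceAs (Algebra ℂ (RingQuot (HeckeRel b ϑ c τ)))

/-- The quotient map from the free algebra onto `H`. -/
def heckeMk (b : P.Base) (ϑ : ι) (c : ℕ) (τ : extAffineWeyl P c → ℝ) :
    FreeAlgebra ℂ (extAffineWeyl P c) →ₐ[ℂ] HeckeAlgebra b ϑ c τ :=
  RingQuot.mkAlgHom ℂ (HeckeRel b ϑ c τ)

/-- The element `T_w` of `H`. -/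
def heckeT (b : P.Base) (ϑ : ι) (c : ℕ) (τ : extAffineWeyl P c → ℝ) (w : extAffineWeyl P c) :
    HeckeAlgebra b ϑ c τ := heckeMk b ϑ c τ (FreeAlgebra.ι ℂ w)

theorem heckeMk_rel (b : P.Base) (ϑ : ι) (c : ℕ) (τ : extAffineWeyl P c → ℝ)
    {x y : FreeAlgebra ℂ (extAffineWeyl P c)} (h : HeckeRel b ϑ c τ x y) :
    heckeMk b ϑ c τ x = heckeMk b ϑ c τ y := RingQuot.mkAlgHom_rel ℂ h

theorem heckeMk_surjective (b : P.Base) (ϑ : ι) (c : ℕ) (τ : extAffineWeyl P c → ℝ) :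
    Function.Surjective (heckeMk b ϑ c τ) := RingQuot.mkAlgHom_surjective ℂ _

/-- The opposite algebra of `A` with complex conjugate scalars. Algebra homomorphisms `A → A*`
are the antilinear antimultiplicative maps `A → A`; this is only used to define the involution. -/
def ConjOp (A : Type*) : Type _ := Aᵐᵒᵖ

instance (A : Type*) [Ring A] : Ring (ConjOp A) := inferInstanceAs (Ring Aᵐᵒᵖ)

instance (A : Type*) [Ring A] [Algebra ℂ A] : Algebra ℂ (ConjOp A) :=
  RingHom.toAlgebra' (S := ConjOp A) ((algebraMap ℂ Aᵐᵒᵖ).comp (starRingEnd ℂ))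
    (fun z x => Algebra.commutes (A := Aᵐᵒᵖ) (conj z) x)

/-- The identity map `A → A*`. -/
def toConjOp {A : Type*} (x : A) : ConjOp A := MulOpposite.op x

/-- The identity map `A* → A`. -/
def ofConjOp {A : Type*} (x : ConjOp A) : A := MulOpposite.unop x

/-- The involution of `H` as a homomorphism into the conjugate opposite algebra: `T_w ↦ T_{w⁻¹}`. -/
def heckeStarHom (b : P.Base) (ϑ : ι) (c : ℕ) (τ : extAffineWeyl P c → ℝ) :
    HeckeAlgebra b ϑ c τ →ₐ[ℂ] ConjOp (HeckeAlgebra b ϑ c τ) :=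
  RingQuot.liftAlgHom ℂ
    ⟨FreeAlgebra.lift ℂ (fun w => toConjOp (heckeT b ϑ c τ w⁻¹)), by
      intro x y h
      induction h with
      | one =>
        rw [FreeAlgebra.lift_ι_apply, map_one, inv_one]
        have := heckeMk_rel b ϑ c τ HeckeRel.one
        rw [map_one] at this
        exact congrArg toConjOp this
      | mul w w' h =>
        rw [map_mul, FreeAlgebra.lift_ι_apply, FreeAlgebra.lift_ι_apply, FreeAlgebra.lift_ι_apply]
        have hl : length b c (w'⁻¹ * w⁻¹ : extAffineWeyl P c) =
            length b c (w'⁻¹ : extAffineWeyl P c) + length b c (w⁻¹ : extAffineWeyl P c) := by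
          rw [← mul_inv_rev, Subgroup.coe_inv, Subgroup.coe_inv, Subgroup.coe_inv, length_inv,
            length_inv, length_inv, h, add_comm]
        have := heckeMk_rel b ϑ c τ (HeckeRel.mul w'⁻¹ w⁻¹ hl)
        rw [map_mul, ← mul_inv_rev] at this
        exact congrArg toConjOp this
      | quad j =>
        have hs : (simpleRefl b ϑ c j)⁻¹ = simpleRefl b ϑ c j := by
          rw [inv_eq_iff_mul_eq_one]
          ext x
          change affRefl P c _ _ (affRefl P c _ _ x) = x
          rw [affRefl_apply, affRefl_apply]
          simp only [affRoot, map_sub, map_smul, RootPairing.root_coroot'_eq_pairing,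
            RootPairing.pairing_same, smul_eq_mul]
          rw [sub_sub, ← add_smul]
          ring_nf
          simp
        have := heckeMk_rel b ϑ c τ (HeckeRel.quad j)
        rw [map_mul, map_sub, map_add, AlgHom.commutes, AlgHom.commutes, map_zero] at this
        rw [map_mul, map_sub, map_add, AlgHom.commutes, AlgHom.commutes, map_zero,
          FreeAlgebra.lift_ι_apply, hs]
        have hc : ∀ z : ℝ, algebraMap ℂ (ConjOp (HeckeAlgebra b ϑ c τ)) (z : ℂ) =
            toConjOp (algebraMap ℂ (HeckeAlgebra b ϑ c τ) (z : ℂ)) := by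
          intro z
          change MulOpposite.op (algebraMap ℂ (HeckeAlgebra b ϑ c τ) (conj (z : ℂ))) = _
          rw [Complex.conj_ofReal]
          rfl
        rw [← Complex.ofReal_inv] at this ⊢
        rw [hc, hc]
        refine congrArg toConjOp (a₂ := 0) ?_
        refine Eq.trans ?_ this
        set A := heckeMk b ϑ c τ (FreeAlgebra.ι ℂ (simpleRefl b ϑ c j)) with hA
        change (A + algebraMap ℂ (HeckeAlgebra b ϑ c τ) ((τ (simpleRefl b ϑ c j))⁻¹ : ℝ)) *
          (A - algebraMap ℂ (HeckeAlgebra b ϑ c τ) (τ (simpleRefl b ϑ c j))) = _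
        generalize ((τ (simpleRefl b ϑ c j))⁻¹ : ℝ) = s
        generalize τ (simpleRefl b ϑ c j) = t
        have h1 := Algebra.commutes (s : ℂ) A
        have h2 := Algebra.commutes (t : ℂ) A
        have h3 := Algebra.commutes (s : ℂ) (algebraMap ℂ (HeckeAlgebra b ϑ c τ) t)
        rw [add_mul, mul_sub, mul_sub, sub_mul, mul_add, mul_add, h1, h2, h3]
        abel⟩

theorem heckeStarHom_T (b : P.Base) (ϑ : ι) (c : ℕ) (τ : extAffineWeyl P c → ℝ)
    (w : extAffineWeyl P c) :
    heckeStarHom b ϑ c τ (heckeT b ϑ c τ w) = toConjOp (heckeT b ϑ c τ w⁻¹) := by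
  have := RingQuot.liftAlgHom_mkAlgHom_apply (S := ℂ)
    (FreeAlgebra.lift ℂ (fun w => toConjOp (heckeT b ϑ c τ w⁻¹)))
    (s := HeckeRel b ϑ c τ) (by
      intro x y h
      have h' := congrArg (heckeStarHom b ϑ c τ) (heckeMk_rel b ϑ c τ h)
      simp only [heckeStarHom, heckeMk] at h'
      exact (RingQuot.liftAlgHom_mkAlgHom_apply _ _ _ _).symm.trans
        (h'.trans (RingQuot.liftAlgHom_mkAlgHom_apply _ _ _ _))) (FreeAlgebra.ι ℂ w)
  rw [FreeAlgebra.lift_ι_apply] at this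
  exact this

/-- `H` is a `*`-algebra, with the antilinear involution determined by `T_w^* = T_{w⁻¹}`. -/
instance (b : P.Base) (ϑ : ι) (c : ℕ) (τ : extAffineWeyl P c → ℝ) :
    StarRing (HeckeAlgebra b ϑ c τ) where
  star h := ofConjOp (heckeStarHom b ϑ c τ h)
  star_involutive := by
    intro h
    change ofConjOp (heckeStarHom b ϑ c τ (ofConjOp (heckeStarHom b ϑ c τ h))) = h
    obtain ⟨x, rfl⟩ := heckeMk_surjective b ϑ c τ h
    induction x using FreeAlgebra.induction with
    | grade0 z =>
      rw [AlgHom.commutes, AlgHom.commutes]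
      change ofConjOp (heckeStarHom b ϑ c τ (algebraMap ℂ _ (conj z))) = _
      rw [AlgHom.commutes]
      change algebraMap ℂ (HeckeAlgebra b ϑ c τ) (conj (conj z)) = _
      rw [Complex.conj_conj]
    | grade1 w =>
      change ofConjOp (heckeStarHom b ϑ c τ (ofConjOp (heckeStarHom b ϑ c τ
        (heckeT b ϑ c τ w)))) = heckeT b ϑ c τ w
      rw [heckeStarHom_T]
      change ofConjOp (heckeStarHom b ϑ c τ (heckeT b ϑ c τ w⁻¹)) = _
      rw [heckeStarHom_T, inv_inv]
      rfl
    | mul x y hx hy =>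
      rw [map_mul, map_mul]
      change ofConjOp (heckeStarHom b ϑ c τ (ofConjOp (heckeStarHom b ϑ c τ (heckeMk b ϑ c τ y)) *
        ofConjOp (heckeStarHom b ϑ c τ (heckeMk b ϑ c τ x)))) = _
      rw [map_mul]
      exact congrArg₂ (· * ·) hx hy
    | add x y hx hy =>
      rw [map_add, map_add]
      change ofConjOp (heckeStarHom b ϑ c τ (ofConjOp (heckeStarHom b ϑ c τ (heckeMk b ϑ c τ x)) +
        ofConjOp (heckeStarHom b ϑ c τ (heckeMk b ϑ c τ y)))) = _
      rw [map_add]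
      exact congrArg₂ (· + ·) hx hy
  star_mul := by
    intro x y
    rw [map_mul]
    rfl
  star_add := by
    intro x y
    rw [map_add]
    rfl

theorem star_heckeT (b : P.Base) (ϑ : ι) (c : ℕ) (τ : extAffineWeyl P c → ℝ)
    (w : extAffineWeyl P c) : star (heckeT b ϑ c τ w) = heckeT b ϑ c τ w⁻¹ :=
  congrArg ofConjOp (heckeStarHom_T b ϑ c τ w)

instance (b : P.Base) (ϑ : ι) (c : ℕ) (τ : extAffineWeyl P c → ℝ) :
    StarModule ℂ (HeckeAlgebra b ϑ c τ) where
  star_smul z h := by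
    rw [Algebra.smul_def, star_mul, Algebra.smul_def]
    have : star (algebraMap ℂ (HeckeAlgebra b ϑ c τ) z) =
        algebraMap ℂ (HeckeAlgebra b ϑ c τ) (star z) :=
      congrArg ofConjOp ((heckeStarHom b ϑ c τ).commutes z)
    rw [this, Algebra.commutes]

end Hecke

/-! The difference-reflection representation and the Hilbert space `l²(P, δ)`. -/

section Representation

variable {ι V N : Type*} [AddCommGroup V] [Module ℝ V] [AddCommGroup N] [Module ℝ N]
  {P : RootPairing ι ℝ V N} [P.IsCrystallographic]

/-- The multiplier `χ_a(x)`, equal to `t`, `1`, `t⁻¹` if `a(x) > 0`, `a(x) = 0`, `a(x) < 0`. -/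
def chi (t : ℝ) (y : ℝ) : ℝ := if 0 < y then t else if y = 0 then 1 else t⁻¹

/-- The action of `w ∈ W` on complex functions on the weight lattice: `(wf)(λ) = f(w⁻¹λ)`. -/
def actOp (c : ℕ) (w : extAffineWeyl P c) : Module.End ℂ (weightLattice P → ℂ) where
  toFun f x := f (w⁻¹ • x)
  map_add' _ _ := rfl
  map_smul' _ _ := rfl

/-- The difference-reflection operator `T̂_j = τ_j + χ_{a_j} (s_j - 1)` on complex functions on the
weight lattice. -/
def diffRefl (b : P.Base) (ϑ : ι) (c : ℕ) (τ : extAffineWeyl P c → ℝ) (j : Option b.support) :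
    Module.End ℂ (weightLattice P → ℂ) where
  toFun f x := (τ (simpleRefl b ϑ c j) : ℂ) * f x +
    (chi (τ (simpleRefl b ϑ c j)) (simpleRoot b ϑ c j x) : ℂ) *
      (actOp c (simpleRefl b ϑ c j) f x - f x)
  map_add' f g := by
    ext x
    simp only [map_add, Pi.add_apply]
    ring
  map_smul' z f := by
    ext x
    simp only [map_smul, Pi.smul_apply, smul_eq_mul, RingHom.id_apply]
    ring

/-- `ρ` is the difference-reflection representation of `H` on the complex functions on the weight
lattice: `T_j ↦ T̂_j` for `j = 0, …, n`, and `T_u ↦ u` for `u ∈ Ω = {u ∈ W | ℓ(u) = 0}`. -/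
structure IsDiffReflRep (b : P.Base) (ϑ : ι) (c : ℕ) (τ : extAffineWeyl P c → ℝ)
    (ρ : HeckeAlgebra b ϑ c τ →ₐ[ℂ] Module.End ℂ (weightLattice P → ℂ)) : Prop where
  simple : ∀ j, ρ (heckeT b ϑ c τ (simpleRefl b ϑ c j)) = diffRefl b ϑ c τ j
  omega : ∀ u : extAffineWeyl P c, length b c u = 0 → ρ (heckeT b ϑ c τ u) = actOp c u

/-- The elements of `W` that lie in the affine Weyl group `W_R`. -/
def affinePart (P : RootPairing ι ℝ V N) (c : ℕ) : Set (extAffineWeyl P c) :=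
  {w | (w : V ≃ᵃ[ℝ] V) ∈ affineWeyl P c}

/-- The weight `δ_λ = W_R(τ²)⁻¹ τ²_{w_λ}` with `W_R(τ²) = ∑_{w ∈ W_R} τ_w²`. -/
def delta (b : P.Base) (c : ℕ) (τ : extAffineWeyl P c → ℝ) (x : weightLattice P) : ℝ :=
  (∑' w : affinePart P c, τ w ^ 2)⁻¹ * τ (shortest b c (x : V)) ^ 2

theorem delta_nonneg (b : P.Base) (c : ℕ) (τ : extAffineWeyl P c → ℝ) (x : weightLattice P) :
    0 ≤ delta b c τ x :=
  mul_nonneg (inv_nonneg.2 (tsum_nonneg fun _ => sq_nonneg _)) (sq_nonneg _)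

/-- The inner product `⟨f, g⟩_δ = ∑_λ f(λ) conj(g(λ)) δ_λ`. -/
def innerDelta (b : P.Base) (c : ℕ) (τ : extAffineWeyl P c → ℝ) (f g : weightLattice P → ℂ) : ℂ :=
  ∑' x, f x * conj (g x) * (delta b c τ x : ℂ)

/-- The space `l²(P, δ)` of functions `f` on the weight lattice with `⟨f, f⟩_δ < ∞`. -/
def l2 (b : P.Base) (c : ℕ) (τ : extAffineWeyl P c → ℝ) : Submodule ℂ (weightLattice P → ℂ) where
  carrier := {f | Summable fun x => ‖f x‖ ^ 2 * delta b c τ x}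
  zero_mem' := by simp [summable_zero]
  add_mem' := fun {f g} hf hg => by
    refine Summable.of_nonneg_of_le
      (fun x => mul_nonneg (sq_nonneg _) (delta_nonneg b c τ x)) (fun x => ?_)
      ((hf.add hg).mul_left 2)
    have h1 : ‖f x + g x‖ ^ 2 ≤ 2 * (‖f x‖ ^ 2 + ‖g x‖ ^ 2) := by
      nlinarith [norm_add_le (f x) (g x), norm_nonneg (f x + g x), sq_nonneg (‖f x‖ - ‖g x‖)]
    have := mul_le_mul_of_nonneg_right h1 (delta_nonneg b c τ x)
    simp only [Pi.add_apply]
    linarith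
  smul_mem' := fun z f hf => by
    refine (Summable.mul_left (‖z‖ ^ 2) hf).congr fun x => ?_
    simp only [Pi.smul_apply, smul_eq_mul, norm_mul]
    ring

/-- The norm `‖f‖_δ = √⟨f, f⟩_δ`. -/
def normDelta (b : P.Base) (c : ℕ) (τ : extAffineWeyl P c → ℝ) (f : weightLattice P → ℂ) : ℝ :=
  √(innerDelta b c τ f f).re

end Representation

end

end CriticalHecke

/-!
The argument rests on one observation: everything in sight can be read off from the affine
hyperplanes that separate a point from the fundamental alcove.

Fix a point `p` in the interior of the alcove and let `negRoots b c x` be the set of positive affine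
roots that are negative at `x`. The length of `w` is the number of elements of `negRoots b c (w p)`
(`length_eq_ncard`), and reflecting a point in a simple wall adds or removes exactly that wall
(`IsHighestShortRoot.negRoots_simpleRefl`). This needs two facts about the highest short root `ϑ`:
the reflection `s_0` permutes the positive affine roots other than `a_0`, because `ϑ` is short and
dominant (`IsHighestShortRoot.comp_simpleRefl_mem`), and the simple affine roots cut out the alcove,
because `ϑ^∨` is the highest coroot (`IsHighestShortRoot.coroot'_le`). It follows that `W` with its
length function has the combinatorics of an extended Coxeter group (`IsLengthSystem`), that
`w_λ` is characterized by its inversions being the walls that separate `λ` from the alcove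
(`IsHighestShortRoot.isDirect_shortest`), and hence that `δ_{s_j λ} = τ_j² δ_λ` whenever
`a_j(λ) > 0` (`delta_simpleRefl`), while `δ` is invariant under elements of length zero.

Existence of the representation does not go through braid relations. On functions on the group `W`
there are left and right Hecke operators, and these commute. An operator that commutes with the
right ones is determined by its values at the unit element (`IsRightEquivariant.ext`), so the
product of left operators along a reduced expression of `w` depends only on `w`. Pulling functions
on the weight lattice back along `w ↦ w λ`, with `λ` in the alcove, turns the
difference-reflection operators into the left Hecke operators (`IsHighestShortRoot.diffRefl_smul`);
as the orbits of such `λ` exhaust the lattice, the operators `T̂_w` are well defined and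
multiplicative where lengths add (`exists_multiplicative_family`). Uniqueness holds because the `T_j` and the `T_u`
with `ℓ(u) = 0` generate `H` (`IsHighestShortRoot.hecke_induction`), and boundedness and the adjoint
relation need to be checked on these generators only. For `T̂_j` the latter is the balance equation
`chi_mul_delta_smul` between `δ_λ` and `δ_{s_j λ}`.

Finally `τ_w²` is at most `q ^ ℓ(w)` for some `q < 1`, and `∑ q ^ ℓ(w)` converges since an element
of `W` is determined by its linear part, for which there are finitely many possibilities, and the image
of the origin, whose coroot coordinates are bounded linearly by the length
(`exists_injective_coordinates`).
-/

open scoped ComplexConjugate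

namespace CriticalHecke

set_option linter.unusedSectionVars false

/-! ### Dominance in a finite root system -/

section FiniteRootSystem

variable {ι V N : Type*} [Fintype ι] [AddCommGroup V] [Module ℝ V] [AddCommGroup N] [Module ℝ N]
  {P : RootPairing ι ℝ V N} [P.IsCrystallographic]

theorem coroot'_reflectionPerm_self (P : RootPairing ι ℝ V N) (i : ι) (x : V) :
    P.coroot' (P.reflectionPerm i i) x = -P.coroot' i x := by
  have : P.coroot (P.reflectionPerm i i) = -P.coroot i := by simp
  rw [RootPairing.coroot', this, map_neg, LinearMap.neg_apply]

theorem coroot'_reflectionPerm_apply (P : RootPairing ι ℝ V N) (i j : ι) (x : V) :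
    P.coroot' (P.reflectionPerm i j) x = P.coroot' j x - P.pairing i j * P.coroot' i x := by
  rw [← P.coroot'_reflection, P.reflection_apply, map_sub, map_smul,
    RootPairing.root_coroot'_eq_pairing, smul_eq_mul, mul_comm]

theorem rootForm_root_pos (P : RootPairing ι ℝ V N) (i : ι) :
    0 < P.RootForm (P.root i) (P.root i) := by
  rw [P.rootForm_root_self]
  refine Finset.sum_pos' (fun j _ => mul_self_nonneg _) ⟨i, Finset.mem_univ i, ?_⟩
  simp

/-- The invariant form turns evaluation of coroots into a linear functional on roots. -/
theorem rootForm_mul_coroot' (P : RootPairing ι ℝ V N) (i : ι) (x : V) :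
    P.RootForm (P.root i) (P.root i) * P.coroot' i x =
      2 * P.toLinearMap x (P.Polarization (P.root i)) := by
  have h := congrArg (P.toLinearMap x) (P.rootForm_self_smul_coroot i)
  rw [map_smul, smul_eq_mul] at h
  rw [map_nsmul, nsmul_eq_mul] at h
  exact_mod_cast h

theorem coroot'_pos_of_isPos {b : P.Base} {x : V} (hx : ∀ j ∈ b.support, 0 < P.coroot' j x)
    {i : ι} (hi : b.IsPos i) : 0 < P.coroot' i x := by
  have key : ∀ i, 0 < P.coroot' i x ↔ 0 < P.toLinearMap x (P.Polarization (P.root i)) := fun i => by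
    have h1 := rootForm_mul_coroot' P i x
    have h2 := rootForm_root_pos P i
    rw [← mul_pos_iff_of_pos_left h2, h1]
    simp
  rw [key]
  refine hi.induction_on_add (fun j hj => (key j).1 (hx j hj)) fun i j k hk hi hj => ?_
  rw [hk, map_add, map_add]
  exact add_pos hi ((key j).1 (hx j hj))

theorem coroot'_nonneg_of_isPos {b : P.Base} {x : V} (hx : ∀ j ∈ b.support, 0 ≤ P.coroot' j x)
    {i : ι} (hi : b.IsPos i) : 0 ≤ P.coroot' i x := by
  have key : ∀ i, 0 ≤ P.coroot' i x ↔ 0 ≤ P.toLinearMap x (P.Polarization (P.root i)) := fun i => by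
    have h1 := rootForm_mul_coroot' P i x
    have h2 := rootForm_root_pos P i
    rw [← mul_nonneg_iff_of_pos_left h2, h1]
    simp
  rw [key]
  refine hi.induction_on_add (fun j hj => (key j).1 (hx j hj)) fun i j k hk hi hj => ?_
  rw [hk, map_add, map_add]
  exact add_nonneg hi ((key j).1 (hx j hj))

/-- The point in question is the sum of the fundamental weights. -/
theorem exists_coroot'_eq_one [P.IsRootSystem] (b : P.Base) :
    ∃ x : V, ∀ j ∈ b.support, P.coroot' j x = 1 := by
  refine ⟨P.toPerfPair.symm (b.toCoweightBasis.constr ℝ fun _ => (1 : ℝ)), fun j hj => ?_⟩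
  have h : P.toLinearMap (P.toPerfPair.symm (b.toCoweightBasis.constr ℝ fun _ => (1 : ℝ))) =
      b.toCoweightBasis.constr ℝ fun _ => (1 : ℝ) := P.toPerfPair.apply_symm_apply _
  rw [RootPairing.coroot', LinearMap.flip_apply, h]
  simpa using b.toCoweightBasis.constr_basis ℝ (fun _ => (1 : ℝ)) ⟨j, hj⟩

theorem isPos_or_isPos_reflectionPerm_self (b : P.Base) (i : ι) :
    b.IsPos i ∨ b.IsPos (P.reflectionPerm i i) := RootPairing.Base.IsPos.or_neg b i

theorem isPos_reflectionPerm_self_iff (b : P.Base) (i : ι) :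
    b.IsPos (P.reflectionPerm i i) ↔ ¬ b.IsPos i := RootPairing.Base.IsPos.neg_iff_not b i

end FiniteRootSystem

/-! ### The highest short root -/

section HighestShortRoot

variable {ι V N : Type*} [Fintype ι] [AddCommGroup V] [Module ℝ V] [AddCommGroup N] [Module ℝ N]
  {P : RootPairing ι ℝ V N} [P.IsRootSystem] [P.IsCrystallographic] {b : P.Base} {ϑ : ι}

theorem IsHighestShortRoot.pairing_nonneg (hϑ : IsHighestShortRoot b ϑ) {i : ι}
    (hi : i ∈ b.support) : 0 ≤ P.pairing ϑ i := by
  have h1 : P.root ϑ - P.root (P.reflectionPerm i ϑ) ∈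
      AddSubmonoid.closure (P.root '' b.support) := by
    refine hϑ.highest _ fun k => ?_
    rw [P.root_reflectionPerm, P.rootForm_reflection_reflection_apply]
    exact hϑ.short k
  rw [P.root_reflectionPerm, P.reflection_apply_root, sub_sub_cancel] at h1
  have h2 : ∀ y ∈ AddSubmonoid.closure (P.root '' b.support),
      0 ≤ b.toWeightBasis.repr y ⟨i, hi⟩ := by
    classical
    intro y hy
    induction hy using AddSubmonoid.closure_induction with
    | mem y hy =>
      obtain ⟨k, hk, rfl⟩ := hy
      have := b.toWeightBasis_repr_root ⟨k, hk⟩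
      simp only at this
      rw [this, Finsupp.single_apply]
      split_ifs <;> norm_num
    | zero => simp
    | add y z _ _ hy hz => rw [map_add, Finsupp.add_apply]; exact add_nonneg hy hz
  have h3 := h2 _ h1
  have h4 := b.toWeightBasis_repr_root ⟨i, hi⟩
  simp only at h4
  rw [map_smul, h4] at h3
  simpa using h3

theorem IsHighestShortRoot.pairing_nonneg_of_isPos (hϑ : IsHighestShortRoot b ϑ) {i : ι}
    (hi : b.IsPos i) : 0 ≤ P.pairing ϑ i := by
  rw [← P.root_coroot'_eq_pairing]
  exact coroot'_nonneg_of_isPos (fun j hj => by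
    rw [P.root_coroot'_eq_pairing]; exact hϑ.pairing_nonneg hj) hi

theorem IsHighestShortRoot.isPos (hϑ : IsHighestShortRoot b ϑ) : b.IsPos ϑ := by
  rcases isPos_or_isPos_reflectionPerm_self b ϑ with h | h
  · exact h
  · have := hϑ.pairing_nonneg_of_isPos h
    rw [P.pairing_reflectionPerm_self_right, P.pairing_same] at this
    linarith

/-- As `ϑ` is short, its pairing with the coroot of any root other than `±ϑ` is `-1`, `0` or `1`. -/
theorem IsHighestShortRoot.pairing_mem (hϑ : IsHighestShortRoot b ϑ) {i : ι} (h1 : i ≠ ϑ)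
    (h2 : i ≠ P.reflectionPerm ϑ ϑ) :
    P.pairing ϑ i = -1 ∨ P.pairing ϑ i = 0 ∨ P.pairing ϑ i = 1 := by
  by_contra hcon
  have h3 : P.pairingIn ℤ ϑ i ∉ ({-1, 0, 1} : Set ℤ) := by
    intro h
    apply hcon
    rw [← P.algebraMap_pairingIn ℤ]
    rcases h with h | h | h <;> rw [h] <;> simp
  have h4 := (P.posRootForm ℤ).rootLength_lt_of_pairingIn_notMem (i := ϑ) (j := i)
    (fun h => h1 (P.root.injective h).symm) (fun h => h2 (by
      rw [← P.root_eq_neg_iff, h, neg_neg])) h3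
  have h5 := hϑ.short i
  have h6 : ∀ k, ((P.posRootForm ℤ).rootLength k : ℝ) = P.RootForm (P.root k) (P.root k) :=
    fun k => (P.posRootForm ℤ).algebraMap_rootLength k
  rw [← h6, ← h6] at h5
  exact absurd h4 (not_lt.2 (by exact_mod_cast h5))

end HighestShortRoot

section HighestShortRootIrreducible

variable {ι V N : Type*} [Fintype ι] [AddCommGroup V] [Module ℝ V] [AddCommGroup N] [Module ℝ N]
  {P : RootPairing ι ℝ V N} [P.IsRootSystem] [P.IsCrystallographic] [P.IsReduced]
  [P.IsIrreducible] {b : P.Base} {ϑ : ι}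

/-- By irreducibility, every simple root occurs in the expansion of `ϑ` with a positive
coefficient: the span of those that do occur is stable under the simple reflections. -/
theorem IsHighestShortRoot.exists_eq_sum_pos (hϑ : IsHighestShortRoot b ϑ) :
    ∃ f : ι → ℤ, (∀ j ∈ b.support, 0 < f j) ∧ P.root ϑ = ∑ j ∈ b.support, f j • P.root j := by
  obtain ⟨f, hf0, hf1, hf2⟩ := b.exists_root_eq_sum_int ϑ
  have hf : 0 ≤ f := by
    refine (hf1.resolve_right fun h => ?_).le
    have h1 := hϑ.isPos
    rw [RootPairing.Base.isPos_iff, RootPairing.Base.height_eq_sum hf2] at h1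
    exact absurd h1 (not_lt.2 (Finset.sum_nonpos fun i _ => h.le i))
  refine ⟨f, ?_, hf2⟩
  by_contra! hcon
  obtain ⟨j, hj, hfj⟩ := hcon
  set I : Set ι := {i | i ∈ b.support ∧ f i ≠ 0} with hI
  set q : Submodule ℝ V := Submodule.span ℝ (P.root '' I) with hq
  have hpair : ∀ i, P.pairing ϑ i = ∑ k ∈ b.support, (f k : ℝ) * P.pairing k i := fun i => by
    rw [← P.root_coroot'_eq_pairing, hf2, map_sum]
    refine Finset.sum_congr rfl fun k _ => ?_
    rw [map_zsmul, P.root_coroot'_eq_pairing, zsmul_eq_mul]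
  have hinv : ∀ i ∈ b.support, q ∈ Module.End.invtSubmodule (P.reflection i) := by
    intro i hi
    by_cases hiI : i ∈ I
    · exact Submodule.mem_invtSubmodule_reflection_of_mem _ _
        (Submodule.subset_span ⟨i, hiI, rfl⟩)
    · have hfi : f i = 0 := by
        by_contra h
        exact hiI ⟨hi, h⟩
      have hle : ∀ k ∈ b.support, (f k : ℝ) * P.pairing k i ≤ 0 := by
        intro k hk
        rcases eq_or_ne k i with rfl | hki
        · simp [hfi]
        · have h1 := b.pairingIn_le_zero_of_ne hki hk hi
          rw [← P.algebraMap_pairingIn ℤ]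
          exact mul_nonpos_of_nonneg_of_nonpos (by exact_mod_cast hf k) (by
            simpa using h1)
      have hsum : ∑ k ∈ b.support, (f k : ℝ) * P.pairing k i = 0 :=
        le_antisymm (Finset.sum_nonpos hle) (hpair i ▸ hϑ.pairing_nonneg hi)
      have hzero := (Finset.sum_eq_zero_iff_of_nonpos hle).1 hsum
      refine (Module.End.mem_invtSubmodule _).mpr fun x hx => ?_
      have hfix := RootPairing.isFixedPt_reflection_of_isOrthogonal (P := P) (j := i) (s := I)
        (fun k hk => by
          have h0 : P.pairing k i = 0 :=
            (mul_eq_zero.1 (hzero k hk.1)).resolve_left (by exact_mod_cast hk.2)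
          exact ⟨P.pairing_eq_zero_iff'.1 h0, h0⟩) hx
      rw [Submodule.mem_comap, LinearEquiv.coe_coe, hfix.eq]
      exact hx
  have hϑq : P.root ϑ ∈ q := by
    rw [hf2]
    refine Submodule.sum_mem _ fun k hk => ?_
    by_cases hfk : f k = 0
    · simp [hfk]
    · have hk' : P.root k ∈ q := Submodule.subset_span ⟨k, ⟨hk, hfk⟩, rfl⟩
      exact zsmul_mem hk' _
  have htop : q = ⊤ := RootPairing.IsIrreducible.eq_top_of_invtSubmodule_reflection (P := P) q
    ((b.forall_mem_support_invtSubmodule_iff q).1 hinv)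
    (fun h => P.ne_zero ϑ (by simpa [h] using hϑq))
  have hjI : j ∉ I := fun h => h.2 (le_antisymm hfj (hf j))
  have hind : LinearIndepOn ℝ P.root (insert j I) := b.linearIndepOn_root.mono
    (Set.insert_subset hj fun k hk => hk.1)
  exact ((hind.mono (Set.subset_insert j I)).notMem_span_iff.2 ⟨hind, hjI⟩)
    (htop.symm ▸ Submodule.mem_top : P.root j ∈ q)

/-- A dominant coroot pairs strictly positively with `ϑ`. -/
theorem IsHighestShortRoot.pairing_pos (hϑ : IsHighestShortRoot b ϑ) {i : ι}
    (hi : ∀ j ∈ b.support, 0 ≤ P.pairing j i) : 0 < P.pairing ϑ i := by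
  obtain ⟨f, hf, hsum⟩ := hϑ.exists_eq_sum_pos
  obtain ⟨j, hj, hne⟩ := b.exists_mem_support_pos_pairingIn_ne_zero i
  rw [← P.root_coroot'_eq_pairing, hsum, map_sum]
  refine Finset.sum_pos' (fun k hk => ?_) ⟨j, hj, ?_⟩
  · rw [map_zsmul, P.root_coroot'_eq_pairing, zsmul_eq_mul]
    exact mul_nonneg (by exact_mod_cast (hf k hk).le) (hi k hk)
  · rw [map_zsmul, P.root_coroot'_eq_pairing, zsmul_eq_mul]
    refine mul_pos (by exact_mod_cast hf j hj) (lt_of_le_of_ne (hi j hj) fun h => hne ?_)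
    rw [← P.algebraMap_pairingIn ℤ] at h
    simpa using h.symm

/-- `ϑ^∨` is the highest coroot: it dominates all coroots on the closed dominant chamber. -/
theorem IsHighestShortRoot.coroot'_le (hϑ : IsHighestShortRoot b ϑ) {x : V}
    (hx : ∀ j ∈ b.support, 0 ≤ P.coroot' j x) (i : ι) : P.coroot' i x ≤ P.coroot' ϑ x := by
  obtain ⟨p, hp⟩ := exists_coroot'_eq_one b
  -- Among the coroots dominating `α_i^∨`, one of maximal height is dominant.
  set S : Set ι := {k | ∀ y, (∀ j ∈ b.support, 0 ≤ P.coroot' j y) →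
    P.coroot' i y ≤ P.coroot' k y} with hS
  obtain ⟨k, hkS, hkmax⟩ := Set.exists_max_image S (fun k => P.coroot' k p) (Set.toFinite S)
    ⟨i, fun y _ => le_rfl⟩
  have hkdom : ∀ j ∈ b.support, 0 ≤ P.pairing j k := by
    intro j hj
    by_contra! hneg
    have hmem : P.reflectionPerm j k ∈ S := fun y hy => by
      rw [coroot'_reflectionPerm_apply]
      nlinarith [hkS y hy, hy j hj]
    have := hkmax _ hmem
    rw [coroot'_reflectionPerm_apply, hp j hj] at this
    linarith
  refine (hkS x hx).trans ?_
  have hpos := hϑ.pairing_pos hkdom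
  by_cases h1 : k = ϑ
  · rw [h1]
  by_cases h2 : k = P.reflectionPerm ϑ ϑ
  · rw [h2, P.pairing_reflectionPerm_self_right, P.pairing_same] at hpos
    linarith
  have h3 : P.pairing ϑ k = 1 := by
    rcases hϑ.pairing_mem h1 h2 with h | h | h
    · linarith
    · linarith
    · exact h
  -- `s_ϑ α_k^∨ = α_k^∨ - ϑ^∨` pairs negatively with the dominant root `ϑ`, so it is negative.
  have h4 : b.IsPos (P.reflectionPerm (P.reflectionPerm ϑ k) (P.reflectionPerm ϑ k)) := by
    rw [isPos_reflectionPerm_self_iff]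
    intro h
    have := hϑ.pairing_nonneg_of_isPos h
    rw [P.pairing_reflectionPerm, P.pairing_reflectionPerm_self_left, h3] at this
    linarith
  have h5 := coroot'_nonneg_of_isPos hx h4
  rw [coroot'_reflectionPerm_self, coroot'_reflectionPerm_apply, h3] at h5
  linarith

end HighestShortRootIrreducible

/-! ### Affine roots -/

section AffineRoots

variable {ι V N : Type*} [Fintype ι] [AddCommGroup V] [Module ℝ V] [AddCommGroup N] [Module ℝ N]
  {P : RootPairing ι ℝ V N} [P.IsCrystallographic]

theorem neg_affRoot (P : RootPairing ι ℝ V N) (c : ℕ) (i : ι) (r : ℤ) :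
    -affRoot P c i r = affRoot P c (P.reflectionPerm i i) (-r) := by
  ext x
  simp only [Pi.neg_apply, affRoot, coroot'_reflectionPerm_self]
  push_cast
  ring

theorem affRoot_reflection (P : RootPairing ι ℝ V N) (c : ℕ) (i k : ι) (r : ℤ) (x : V) :
    affRoot P c i r (P.reflection k x) = affRoot P c (P.reflectionPerm k i) r x := by
  rw [affRoot, affRoot, P.coroot'_reflection]

/-- `W` permutes the affine roots; its linear part moves the gradients accordingly. -/
theorem exists_affRoot_comp (P : RootPairing ι ℝ V N) [P.IsCrystallographic] {c : ℕ}
    {w : V ≃ᵃ[ℝ] V} (hw : w ∈ extAffineWeyl P c) (i : ι) (r : ℤ) :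
    ∃ i' r', affRoot P c i r ∘ w = affRoot P c i' r' ∧ w.linear (P.root i') = P.root i := by
  have hrefl : ∀ k i r, ∃ i' r',
      affRoot P c i r ∘ (P.reflection k).toAffineEquiv = affRoot P c i' r' ∧
        (P.reflection k).toAffineEquiv.linear (P.root i') = P.root i := fun k i r =>
    ⟨P.reflectionPerm k i, r, funext fun x => affRoot_reflection P c i k r x, by
      change P.reflection k _ = _
      rw [P.root_reflectionPerm, P.reflection_same]⟩
  have htr : ∀ y ∈ weightLattice P, ∀ i r, ∃ i' r',
      affRoot P c i r ∘ translation ((c : ℝ) • y) = affRoot P c i' r' ∧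
        (translation ((c : ℝ) • y)).linear (P.root i') = P.root i := fun y hy i r => by
    obtain ⟨n, hn⟩ := hy i
    refine ⟨i, r + n, funext fun x => ?_, rfl⟩
    simp only [Function.comp_apply, translation, AffineEquiv.constVAdd_apply, vadd_eq_add, affRoot,
      map_add, map_smul, hn, smul_eq_mul]
    push_cast
    ring
  unfold extAffineWeyl at hw
  induction hw using Subgroup.closure_induction'' generalizing i r with
  | one => exact ⟨i, r, rfl, rfl⟩
  | mem g hg =>
    rcases hg with ⟨k, rfl⟩ | ⟨y, hy, rfl⟩
    · exact hrefl k i r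
    · exact htr y hy i r
  | inv_mem g hg =>
    rcases hg with ⟨k, rfl⟩ | ⟨y, hy, rfl⟩
    · have : ((P.reflection k).toAffineEquiv)⁻¹ = (P.reflection k).toAffineEquiv := by
        rw [inv_eq_iff_mul_eq_one]
        ext x
        exact P.reflection_same k x
      rw [this]
      exact hrefl k i r
    · have : (translation ((c : ℝ) • y))⁻¹ = translation ((c : ℝ) • (-y)) := by
        rw [inv_eq_iff_mul_eq_one]
        ext x
        simp [translation, AffineEquiv.mul_def]
      rw [this]
      exact htr _ (neg_mem hy) i r
  | mul g h _ _ hg hh =>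
    obtain ⟨i', r', h1, h2⟩ := hg i r
    obtain ⟨i'', r'', h3, h4⟩ := hh i' r'
    refine ⟨i'', r'', ?_, ?_⟩
    · rw [← h3, ← h1]
      rfl
    · rw [← h2, ← h4]
      rfl

theorem affRoot_mem_or_neg_mem (b : P.Base) (c : ℕ) (i : ι) (r : ℤ) :
    affRoot P c i r ∈ posAffRoots b c ∨ -affRoot P c i r ∈ posAffRoots b c := by
  rcases lt_trichotomy r 0 with hr | rfl | hr
  · right
    rw [neg_affRoot]
    exact Or.inr ⟨_, -r, by omega, rfl⟩
  · rcases isPos_or_isPos_reflectionPerm_self b i with h | h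
    · exact Or.inl (Or.inl ⟨i, h, rfl⟩)
    · right
      rw [neg_affRoot, neg_zero]
      exact Or.inl ⟨_, h, rfl⟩
  · exact Or.inl (Or.inr ⟨i, r, by omega, rfl⟩)

theorem exists_eq_affRoot {b : P.Base} {c : ℕ} {a : V → ℝ} (ha : a ∈ posAffRoots b c) :
    ∃ i r, 0 ≤ r ∧ (r = 0 → b.IsPos i) ∧ a = affRoot P c i r := by
  rcases ha with ⟨i, hi, rfl⟩ | ⟨i, r, hr, rfl⟩
  · exact ⟨i, 0, le_rfl, fun _ => hi, rfl⟩
  · exact ⟨i, r, by omega, fun h => by omega, rfl⟩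

theorem affRoot_mem_posAffRoots {b : P.Base} (c : ℕ) {i : ι} {r : ℤ} (hr : 0 ≤ r)
    (hi : r = 0 → b.IsPos i) : affRoot P c i r ∈ posAffRoots b c := by
  rcases hr.eq_or_lt with rfl | hr
  · exact Or.inl ⟨i, hi rfl, rfl⟩
  · exact Or.inr ⟨i, r, by omega, rfl⟩

theorem abs_coroot'_le_sum (P : RootPairing ι ℝ V N) (i : ι) (x : V) :
    |P.coroot' i x| ≤ ∑ k, |P.coroot' k x| :=
  Finset.single_le_sum (f := fun k => |P.coroot' k x|) (fun _ _ => abs_nonneg _)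
    (Finset.mem_univ i)

/-- The open fundamental alcove is nonempty. -/
theorem exists_forall_posAffRoots_pos [P.IsRootSystem] (b : P.Base) {c : ℕ} (hc : 0 < c) :
    ∃ p : V, ∀ a ∈ posAffRoots b c, 0 < a p := by
  obtain ⟨x, hx⟩ := exists_coroot'_eq_one b
  set M : ℝ := ∑ k, |P.coroot' k x| with hM
  have hM0 : 0 ≤ M := Finset.sum_nonneg fun _ _ => abs_nonneg _
  have hc' : (0 : ℝ) < c := by exact_mod_cast hc
  set e : ℝ := c / (M + 1) with he
  have he0 : 0 < e := by positivity
  have heM : e * M < c := by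
    rw [he, div_mul_eq_mul_div, div_lt_iff₀ (by positivity)]
    nlinarith
  refine ⟨e • x, fun a ha => ?_⟩
  rcases ha with ⟨i, hi, rfl⟩ | ⟨i, r, hr, rfl⟩
  · have := coroot'_pos_of_isPos (x := x) (fun j hj => by rw [hx j hj]; exact one_pos) hi
    simp only [affRoot, map_smul, smul_eq_mul, Int.cast_zero, zero_mul, add_zero]
    positivity
  · simp only [affRoot, map_smul, smul_eq_mul]
    have h1 := neg_abs_le (P.coroot' i x)
    have h2 := abs_coroot'_le_sum P i x
    have h3 : (1 : ℝ) ≤ r := by exact_mod_cast hr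
    nlinarith

/-- The set of positive affine roots that are negative at `x`. They are the walls separating `x`
from the fundamental alcove. -/
def negRoots (b : P.Base) (c : ℕ) (x : V) : Set (V → ℝ) := {a | a ∈ posAffRoots b c ∧ a x < 0}

theorem finite_negRoots (b : P.Base) {c : ℕ} (hc : 0 < c) (x : V) : (negRoots b c x).Finite := by
  set M : ℝ := ∑ k, |P.coroot' k x| with hM
  refine ((Set.finite_univ.prod (Set.finite_Icc (0 : ℤ) ⌈M⌉)).image
    fun q : ι × ℤ => affRoot P c q.1 q.2).subset ?_
  rintro a ⟨ha, hax⟩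
  obtain ⟨i, r, hr, -, rfl⟩ := exists_eq_affRoot ha
  refine ⟨(i, r), ⟨Set.mem_univ _, hr, ?_⟩, rfl⟩
  have h1 := neg_abs_le (P.coroot' i x)
  have h2 := abs_coroot'_le_sum P i x
  have h3 : (1 : ℝ) ≤ c := by exact_mod_cast hc
  have h4 : (0 : ℝ) ≤ r := by exact_mod_cast hr
  have h5 : (r : ℝ) ≤ M := by
    simp only [affRoot] at hax
    nlinarith
  exact_mod_cast h5.trans (Int.le_ceil M)

end AffineRoots

/-! ### Simple affine reflections -/

section SimpleReflections

variable {ι V N : Type*} [Fintype ι] [AddCommGroup V] [Module ℝ V] [AddCommGroup N] [Module ℝ N]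
  {P : RootPairing ι ℝ V N} [P.IsRootSystem] [P.IsCrystallographic] {b : P.Base} {ϑ : ι}

theorem simpleRefl_apply (b : P.Base) (ϑ : ι) (c : ℕ) (j : Option b.support) (x : V) :
    (simpleRefl b ϑ c j : V ≃ᵃ[ℝ] V) x =
      x - simpleRoot b ϑ c j x • P.root (simpleIdx b ϑ j).1 :=
  affRefl_apply P c _ _ x

theorem simpleRoot_simpleRefl (b : P.Base) (ϑ : ι) (c : ℕ) (j : Option b.support) (x : V) :
    simpleRoot b ϑ c j ((simpleRefl b ϑ c j : V ≃ᵃ[ℝ] V) x) = -simpleRoot b ϑ c j x := by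
  rw [simpleRefl_apply]
  simp only [simpleRoot, affRoot, map_sub, map_smul, smul_eq_mul,
    RootPairing.root_coroot'_eq_pairing, RootPairing.pairing_same]
  ring

theorem simpleRefl_apply_of_eq_zero {c : ℕ} {j : Option b.support} {x : V}
    (hx : simpleRoot b ϑ c j x = 0) : (simpleRefl b ϑ c j : V ≃ᵃ[ℝ] V) x = x := by
  rw [simpleRefl_apply, hx, zero_smul, sub_zero]

theorem simpleRefl_mul_self (b : P.Base) (ϑ : ι) (c : ℕ) (j : Option b.support) :
    simpleRefl b ϑ c j * simpleRefl b ϑ c j = 1 := by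
  ext x
  change (simpleRefl b ϑ c j : V ≃ᵃ[ℝ] V) ((simpleRefl b ϑ c j : V ≃ᵃ[ℝ] V) x) = x
  rw [simpleRefl_apply b ϑ c j (_), simpleRoot_simpleRefl, simpleRefl_apply]
  simp

theorem simpleRefl_inv (b : P.Base) (ϑ : ι) (c : ℕ) (j : Option b.support) :
    (simpleRefl b ϑ c j)⁻¹ = simpleRefl b ϑ c j :=
  inv_eq_of_mul_eq_one_right (simpleRefl_mul_self b ϑ c j)

theorem simpleRefl_mem_affineWeyl (b : P.Base) (ϑ : ι) (c : ℕ) (j : Option b.support) :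
    (simpleRefl b ϑ c j : V ≃ᵃ[ℝ] V) ∈ affineWeyl P c :=
  Subgroup.subset_closure ⟨_, _, rfl⟩

theorem simpleRefl_some_apply (b : P.Base) (ϑ : ι) (c : ℕ) (j : b.support) (x : V) :
    (simpleRefl b ϑ c (some j) : V ≃ᵃ[ℝ] V) x = P.reflection j x := by
  rw [simpleRefl_apply, P.reflection_apply]
  simp [simpleRoot, simpleIdx, affRoot]

theorem simpleRoot_none_apply (b : P.Base) (ϑ : ι) (c : ℕ) (x : V) :
    simpleRoot b ϑ c none x = c - P.coroot' ϑ x := by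
  simp only [simpleRoot, simpleIdx, affRoot, coroot'_reflectionPerm_self]
  push_cast
  ring

theorem simpleRoot_some_apply (b : P.Base) (ϑ : ι) (c : ℕ) (j : b.support) (x : V) :
    simpleRoot b ϑ c (some j) x = P.coroot' j x := by
  simp [simpleRoot, simpleIdx, affRoot]

theorem affRoot_simpleRefl_none (b : P.Base) (ϑ : ι) (c : ℕ) (i : ι) (r : ℤ) (x : V) :
    affRoot P c i r ((simpleRefl b ϑ c none : V ≃ᵃ[ℝ] V) x) =
      affRoot P c (P.reflectionPerm ϑ i) (r + P.pairingIn ℤ ϑ i) x := by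
  have h : ((P.pairingIn ℤ ϑ i : ℤ) : ℝ) = P.pairing ϑ i := P.algebraMap_pairingIn ℤ ϑ i
  rw [simpleRefl_apply, simpleRoot_none_apply]
  simp only [affRoot, simpleIdx, coroot'_reflectionPerm_apply, P.root_reflectionPerm,
    P.reflection_apply_self, map_sub, map_smul, map_neg, RootPairing.root_coroot'_eq_pairing,
    smul_eq_mul]
  push_cast
  rw [h]
  ring

theorem simpleRoot_mem_posAffRoots (b : P.Base) (ϑ : ι) (c : ℕ) (j : Option b.support) :
    simpleRoot b ϑ c j ∈ posAffRoots b c := by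
  cases j with
  | none => exact Or.inr ⟨_, 1, le_rfl, rfl⟩
  | some j => exact Or.inl ⟨j, RootPairing.Base.isPos_of_mem_support j.2, rfl⟩

/-- A simple affine reflection permutes the positive affine roots other than its own. For `s_0` this
uses that `ϑ` is short and dominant. -/
theorem IsHighestShortRoot.comp_simpleRefl_mem [P.IsReduced] (hϑ : IsHighestShortRoot b ϑ) {c : ℕ}
    {a : V → ℝ} (ha : a ∈ posAffRoots b c) {j : Option b.support} (haj : a ≠ simpleRoot b ϑ c j) :
    a ∘ (simpleRefl b ϑ c j : V ≃ᵃ[ℝ] V) ∈ posAffRoots b c := by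
  cases j with
  | some j =>
    have hcomp : ∀ i r, affRoot P c i r ∘ (simpleRefl b ϑ c (some j) : V ≃ᵃ[ℝ] V) =
        affRoot P c (P.reflectionPerm j i) r := fun i r => funext fun x => by
      rw [Function.comp_apply, simpleRefl_some_apply, affRoot_reflection]
    rcases ha with ⟨i, hi, rfl⟩ | ⟨i, r, hr, rfl⟩
    · rw [hcomp]
      refine Or.inl ⟨_, hi.reflectionPerm j.2 ?_, rfl⟩
      rintro rfl
      exact haj rfl
    · rw [hcomp]
      exact Or.inr ⟨_, r, hr, rfl⟩
  | none =>
    obtain ⟨i, r, hr, hr0, rfl⟩ := exists_eq_affRoot ha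
    have hcomp : affRoot P c i r ∘ (simpleRefl b ϑ c none : V ≃ᵃ[ℝ] V) =
        affRoot P c (P.reflectionPerm ϑ i) (r + P.pairingIn ℤ ϑ i) :=
      funext fun x => affRoot_simpleRefl_none b ϑ c i r x
    rw [hcomp]
    have hm : ∀ m : ℤ, P.pairing ϑ i = m → P.pairingIn ℤ ϑ i = m := fun m h => by
      have : ((P.pairingIn ℤ ϑ i : ℤ) : ℝ) = P.pairing ϑ i := P.algebraMap_pairingIn ℤ ϑ i
      rw [h] at this
      exact_mod_cast this
    by_cases h1 : i = ϑ
    · have h2 : P.pairingIn ℤ ϑ i = 2 := by rw [h1, P.pairingIn_same]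
      exact affRoot_mem_posAffRoots c (by omega) fun h => by omega
    by_cases h2 : i = P.reflectionPerm ϑ ϑ
    · have h3 : P.pairingIn ℤ ϑ i = -2 := hm _ (by
        rw [h2, P.pairing_reflectionPerm_self_right, P.pairing_same]
        norm_num)
      have h4 : r ≠ 1 := by
        rintro rfl
        exact haj (by rw [h2]; rfl)
      have h5 : r ≠ 0 := fun h => by
        have h6 := hr0 h
        rw [h2, isPos_reflectionPerm_self_iff] at h6
        exact h6 hϑ.isPos
      refine affRoot_mem_posAffRoots c (by omega) fun _ => ?_
      rw [h2, P.reflectionPerm_self]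
      exact hϑ.isPos
    rcases hϑ.pairing_mem h1 h2 with h | h | h
    · have h3 : P.pairingIn ℤ ϑ i = -1 := hm _ (by rw [h]; norm_num)
      have h4 : r ≠ 0 := fun h0 => by
        have := hϑ.pairing_nonneg_of_isPos (hr0 h0)
        linarith
      refine affRoot_mem_posAffRoots c (by omega) fun _ => ?_
      by_contra h5
      rw [← isPos_reflectionPerm_self_iff] at h5
      have := hϑ.pairing_nonneg_of_isPos h5
      rw [P.pairing_reflectionPerm_self_right, P.pairing_reflectionPerm,
        P.pairing_reflectionPerm_self_left] at this
      linarith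
    · have h3 : P.pairingIn ℤ ϑ i = 0 := hm _ (by rw [h]; norm_num)
      rw [h3, add_zero, P.reflectionPerm_eq_of_pairing_eq_zero' h]
      exact ha
    · have h3 : P.pairingIn ℤ ϑ i = 1 := hm _ (by rw [h]; norm_num)
      exact affRoot_mem_posAffRoots c (by omega) fun h => by omega

theorem IsHighestShortRoot.nonneg_of_forall_simpleRoot_nonneg [P.IsReduced] [P.IsIrreducible]
    (hϑ : IsHighestShortRoot b ϑ) {c : ℕ} {x : V} (hx : ∀ j, 0 ≤ simpleRoot b ϑ c j x) {a : V → ℝ}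
    (ha : a ∈ posAffRoots b c) : 0 ≤ a x := by
  have hdom : ∀ j ∈ b.support, 0 ≤ P.coroot' j x := fun j hj => by
    simpa [simpleRoot_some_apply] using hx (some ⟨j, hj⟩)
  rcases ha with ⟨i, hi, rfl⟩ | ⟨i, r, hr, rfl⟩
  · simpa [affRoot] using coroot'_nonneg_of_isPos hdom hi
  · have h1 := hϑ.coroot'_le hdom (P.reflectionPerm i i)
    have h2 := hx none
    rw [coroot'_reflectionPerm_self] at h1
    rw [simpleRoot_none_apply] at h2
    have h3 : (1 : ℝ) ≤ r := by exact_mod_cast hr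
    have h4 : (0 : ℝ) ≤ c := Nat.cast_nonneg c
    simp only [affRoot]
    nlinarith

end SimpleReflections

/-! ### Length and hyperplane crossings -/

section Crossings

variable {ι V N : Type*} [Fintype ι] [AddCommGroup V] [Module ℝ V] [AddCommGroup N] [Module ℝ N]
  {P : RootPairing ι ℝ V N} [P.IsRootSystem] [P.IsCrystallographic] {b : P.Base} {ϑ : ι}
  {c : ℕ} {p : V}

theorem coe_mul_apply (v w : extAffineWeyl P c) (x : V) :
    ((v * w : extAffineWeyl P c) : V ≃ᵃ[ℝ] V) x = (v : V ≃ᵃ[ℝ] V) ((w : V ≃ᵃ[ℝ] V) x) := rfl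

theorem coe_inv_apply (w : extAffineWeyl P c) (x : V) :
    ((w⁻¹ : extAffineWeyl P c) : V ≃ᵃ[ℝ] V) x = (w : V ≃ᵃ[ℝ] V).symm x := rfl

theorem inv_apply_apply (w : extAffineWeyl P c) (x : V) :
    ((w⁻¹ : extAffineWeyl P c) : V ≃ᵃ[ℝ] V) ((w : V ≃ᵃ[ℝ] V) x) = x :=
  (w : V ≃ᵃ[ℝ] V).symm_apply_apply x

theorem apply_inv_apply (w : extAffineWeyl P c) (x : V) :
    (w : V ≃ᵃ[ℝ] V) (((w⁻¹ : extAffineWeyl P c) : V ≃ᵃ[ℝ] V) x) = x :=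
  (w : V ≃ᵃ[ℝ] V).apply_symm_apply x

theorem comp_mem_or_neg_mem (w : extAffineWeyl P c) {a : V → ℝ} (ha : a ∈ posAffRoots b c) :
    a ∘ (w : V ≃ᵃ[ℝ] V) ∈ posAffRoots b c ∨ -(a ∘ (w : V ≃ᵃ[ℝ] V)) ∈ posAffRoots b c := by
  obtain ⟨i, r, -, -, rfl⟩ := exists_eq_affRoot ha
  obtain ⟨i', r', h, -⟩ := exists_affRoot_comp P w.2 i r
  rw [h]
  exact affRoot_mem_or_neg_mem b c i' r'

theorem comp_mem_posAffRoots_iff (hp : ∀ a ∈ posAffRoots b c, 0 < a p) (w : extAffineWeyl P c)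
    {a : V → ℝ} (ha : a ∈ posAffRoots b c) :
    a ∘ (w : V ≃ᵃ[ℝ] V) ∈ posAffRoots b c ↔ 0 ≤ a ((w : V ≃ᵃ[ℝ] V) p) := by
  refine ⟨fun h => (hp _ h).le, fun h => (comp_mem_or_neg_mem w ha).resolve_right fun h' => ?_⟩
  have := hp _ h'
  simp only [Pi.neg_apply, Function.comp_apply] at this
  linarith

theorem apply_ne_zero (hp : ∀ a ∈ posAffRoots b c, 0 < a p) (w : extAffineWeyl P c)
    {a : V → ℝ} (ha : a ∈ posAffRoots b c) : a ((w : V ≃ᵃ[ℝ] V) p) ≠ 0 := by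
  rcases comp_mem_or_neg_mem w ha with h | h
  · exact (hp _ h).ne'
  · have := hp _ h
    simp only [Pi.neg_apply, Function.comp_apply] at this
    linarith

/-- The inversions of `w` are the walls separating `w⁻¹ p` from the fundamental alcove. -/
theorem inversions_eq_negRoots (hp : ∀ a ∈ posAffRoots b c, 0 < a p) (w : extAffineWeyl P c) :
    inversions b c w = negRoots b c (((w⁻¹ : extAffineWeyl P c) : V ≃ᵃ[ℝ] V) p) := by
  ext a
  refine ⟨fun ⟨h1, h2⟩ => ⟨h1, ?_⟩, fun ⟨h1, h2⟩ => ⟨h1, ?_⟩⟩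
  · have := hp _ h2
    simp only [Pi.neg_apply, Function.comp_apply] at this
    rw [coe_inv_apply]
    linarith
  · refine (comp_mem_or_neg_mem w⁻¹ h1).resolve_left fun h => ?_
    have := hp _ h
    simp only [Function.comp_apply] at this
    linarith

theorem length_eq_ncard (hp : ∀ a ∈ posAffRoots b c, 0 < a p) (w : extAffineWeyl P c) :
    length b c w = (negRoots b c ((w : V ≃ᵃ[ℝ] V) p)).ncard := by
  have h := congrArg Set.ncard (inversions_eq_negRoots hp w⁻¹)
  rw [inv_inv] at h
  rw [← length_inv, ← h]
  rfl

theorem comp_injective (w : V ≃ᵃ[ℝ] V) : Function.Injective fun a : V → ℝ => a ∘ w := by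
  intro a a' h
  ext x
  simpa using congrFun h (w.symm x)

/-- Reflecting a point on the positive side of a simple wall creates exactly one new separating
wall. -/
theorem IsHighestShortRoot.negRoots_simpleRefl [P.IsReduced] (hϑ : IsHighestShortRoot b ϑ)
    {j : Option b.support} {x : V} (hx : 0 < simpleRoot b ϑ c j x) :
    negRoots b c ((simpleRefl b ϑ c j : V ≃ᵃ[ℝ] V) x) = insert (simpleRoot b ϑ c j)
      ((fun a : V → ℝ => a ∘ (simpleRefl b ϑ c j : V ≃ᵃ[ℝ] V)) '' negRoots b c x) := by
  have hinvol : ∀ y, (simpleRefl b ϑ c j : V ≃ᵃ[ℝ] V) ((simpleRefl b ϑ c j : V ≃ᵃ[ℝ] V) y) = y :=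
    fun y => by rw [← coe_mul_apply, simpleRefl_mul_self]; rfl
  ext a
  constructor
  · rintro ⟨h1, h2⟩
    by_cases ha : a = simpleRoot b ϑ c j
    · exact Or.inl ha
    · refine Or.inr ⟨_, ⟨hϑ.comp_simpleRefl_mem h1 ha, h2⟩, funext fun y => ?_⟩
      simp only [Function.comp_apply, hinvol]
  · rintro (rfl | ⟨a, ⟨h1, h2⟩, rfl⟩)
    · refine ⟨simpleRoot_mem_posAffRoots b ϑ c j, ?_⟩
      rw [simpleRoot_simpleRefl]
      linarith
    · refine ⟨hϑ.comp_simpleRefl_mem h1 ?_, ?_⟩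
      · rintro rfl
        linarith
      · simpa only [Function.comp_apply, hinvol] using h2

theorem IsHighestShortRoot.ncard_negRoots_simpleRefl [P.IsReduced] (hϑ : IsHighestShortRoot b ϑ)
    (hc : 0 < c) {j : Option b.support} {x : V} (hx : 0 < simpleRoot b ϑ c j x) :
    (negRoots b c ((simpleRefl b ϑ c j : V ≃ᵃ[ℝ] V) x)).ncard = (negRoots b c x).ncard + 1 := by
  rw [hϑ.negRoots_simpleRefl hx, Set.ncard_insert_of_notMem ?_ ((finite_negRoots b hc x).image _),
    Set.ncard_image_of_injective _ (comp_injective _)]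
  rintro ⟨a, ⟨h1, -⟩, h3⟩
  have h4 : a = -simpleRoot b ϑ c j := by
    refine comp_injective (simpleRefl b ϑ c j : V ≃ᵃ[ℝ] V) (h3.trans (funext fun y => ?_))
    simp only [Function.comp_apply, Pi.neg_apply, simpleRoot_simpleRefl, neg_neg]
  obtain ⟨p, hp⟩ := exists_forall_posAffRoots_pos b hc
  have h5 := hp _ h1
  have h6 := hp _ (simpleRoot_mem_posAffRoots b ϑ c j)
  rw [h4, Pi.neg_apply] at h5
  linarith

theorem IsHighestShortRoot.length_simpleRefl_mul [P.IsReduced] (hϑ : IsHighestShortRoot b ϑ)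
    (hc : 0 < c) (hp : ∀ a ∈ posAffRoots b c, 0 < a p) {j : Option b.support}
    {w : extAffineWeyl P c} (hw : 0 < simpleRoot b ϑ c j ((w : V ≃ᵃ[ℝ] V) p)) :
    length b c (simpleRefl b ϑ c j * w : extAffineWeyl P c) = length b c w + 1 := by
  rw [length_eq_ncard hp, length_eq_ncard hp, coe_mul_apply, hϑ.ncard_negRoots_simpleRefl hc hw]

theorem IsHighestShortRoot.length_eq_add_one [P.IsReduced] (hϑ : IsHighestShortRoot b ϑ)
    (hc : 0 < c) (hp : ∀ a ∈ posAffRoots b c, 0 < a p) {j : Option b.support}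
    {w : extAffineWeyl P c} (hw : simpleRoot b ϑ c j ((w : V ≃ᵃ[ℝ] V) p) < 0) :
    length b c w = length b c (simpleRefl b ϑ c j * w : extAffineWeyl P c) + 1 := by
  rw [← hϑ.length_simpleRefl_mul hc hp (j := j), ← mul_assoc, simpleRefl_mul_self, one_mul]
  rw [coe_mul_apply, simpleRoot_simpleRefl]
  linarith

theorem negRoots_eq_empty_iff {x : V} : negRoots b c x = ∅ ↔ x ∈ alcove b c := by
  rw [Set.eq_empty_iff_forall_notMem]
  refine ⟨fun h a ha => not_lt.1 fun h' => h a ⟨ha, h'⟩, fun h a ha => ?_⟩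
  exact absurd ha.2 (not_lt.2 (h a ha.1))

theorem length_eq_zero_iff (hc : 0 < c) (hp : ∀ a ∈ posAffRoots b c, 0 < a p)
    {w : extAffineWeyl P c} : length b c w = 0 ↔ (w : V ≃ᵃ[ℝ] V) p ∈ alcove b c := by
  rw [length_eq_ncard hp, Set.ncard_eq_zero (finite_negRoots b hc _), negRoots_eq_empty_iff]

/-- An element of length zero carries the separating walls of `x` to those of `u x`. -/
theorem negRoots_of_length_eq_zero (hc : 0 < c) {u : extAffineWeyl P c} (hu : length b c u = 0)
    (x : V) : negRoots b c ((u : V ≃ᵃ[ℝ] V) x) =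
      (fun a : V → ℝ => a ∘ (u : V ≃ᵃ[ℝ] V).symm) '' negRoots b c x := by
  obtain ⟨p, hp⟩ := exists_forall_posAffRoots_pos b hc
  have hu' : length b c (u⁻¹ : extAffineWeyl P c) = 0 := by
    rw [Subgroup.coe_inv, length_inv, hu]
  rw [length_eq_zero_iff hc hp] at hu hu'
  ext a
  constructor
  · rintro ⟨h1, h2⟩
    refine ⟨_, ⟨(comp_mem_posAffRoots_iff hp u h1).2 (hu a h1), h2⟩, funext fun y => ?_⟩
    simp
  · rintro ⟨a, ⟨h1, h2⟩, rfl⟩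
    exact ⟨(comp_mem_posAffRoots_iff hp u⁻¹ h1).2 (hu' a h1), by simpa using h2⟩

theorem coroot'_injective (P : RootPairing ι ℝ V N) : Function.Injective P.coroot' :=
  fun _ _ h => P.coroot.injective (P.flip.toPerfPair.injective h)

theorem affRoot_injective {i i' : ι} {r r' : ℤ} (h : affRoot P c i r = affRoot P c i' r') :
    i = i' := by
  have h0 := congrFun h 0
  simp only [affRoot, map_zero, zero_add] at h0
  refine coroot'_injective P (LinearMap.ext fun x => ?_)
  have hx := congrFun h x
  simp only [affRoot, h0] at hx
  exact add_right_cancel hx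

/-- `w` conjugates `s_k` into `s_j` if it transports the affine root `a_j` into `a_k`. -/
theorem simpleRefl_mul_eq {j k : Option b.support} {w : extAffineWeyl P c}
    (h : simpleRoot b ϑ c j ∘ (w : V ≃ᵃ[ℝ] V) = simpleRoot b ϑ c k) :
    simpleRefl b ϑ c j * w = w * simpleRefl b ϑ c k := by
  obtain ⟨i', r', h1, h2⟩ := exists_affRoot_comp P w.2 (simpleIdx b ϑ j).1 (simpleIdx b ϑ j).2
  have h3 : i' = (simpleIdx b ϑ k).1 := affRoot_injective (h1.symm.trans h)
  rw [h3] at h2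
  ext x
  rw [coe_mul_apply, coe_mul_apply, simpleRefl_apply, simpleRefl_apply, ← congrFun h x,
    sub_eq_add_neg x, add_comm x, ← vadd_eq_add, AffineEquiv.map_vadd]
  simp only [Function.comp_apply, map_neg, map_smul, vadd_eq_add]
  rw [h2]
  abel

end Crossings

/-- The combinatorial properties of the length function `ℓ` of an extended affine Weyl group `W`
with simple reflections `s_j`, `j ∈ J`, that govern its Hecke algebra. -/
structure IsLengthSystem {W J : Type*} [Group W] (ℓ : W → ℕ) (s : J → W) : Prop where
  length_one : ℓ 1 = 0
  length_inv : ∀ w, ℓ w⁻¹ = ℓ w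
  simple_mul_self : ∀ j, s j * s j = 1
  length_simple_mul : ∀ j w, ℓ (s j * w) = ℓ w + 1 ∨ ℓ w = ℓ (s j * w) + 1
  exists_descent : ∀ w, ℓ w ≠ 0 → ∃ j, ℓ (s j * w) < ℓ w
  length_mul_of_eq_zero : ∀ u w, ℓ u = 0 → ℓ (u * w) = ℓ w
  folding : ∀ j k w, ℓ w < ℓ (s j * w) → ℓ (s j * (w * s k)) < ℓ (w * s k) → s j * w = w * s k

section Crossings

variable {ι V N : Type*} [Fintype ι] [AddCommGroup V] [Module ℝ V] [AddCommGroup N] [Module ℝ N]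
  {P : RootPairing ι ℝ V N} [P.IsRootSystem] [P.IsCrystallographic] [P.IsReduced]
  [P.IsIrreducible] {b : P.Base} {ϑ : ι} {c : ℕ}

theorem IsHighestShortRoot.isLengthSystem (hϑ : IsHighestShortRoot b ϑ) (hc : 0 < c) :
    IsLengthSystem (fun w : extAffineWeyl P c => length b c w) (simpleRefl b ϑ c) := by
  obtain ⟨p, hp⟩ := exists_forall_posAffRoots_pos b hc
  have hsimple : ∀ j, simpleRoot b ϑ c j ∈ posAffRoots b c := simpleRoot_mem_posAffRoots b ϑ c
  have hascent : ∀ j (w : extAffineWeyl P c), length b c w <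
      length b c (simpleRefl b ϑ c j * w : extAffineWeyl P c) →
        0 < simpleRoot b ϑ c j ((w : V ≃ᵃ[ℝ] V) p) := fun j w h => by
    rcases (apply_ne_zero hp w (hsimple j)).lt_or_gt with h' | h'
    · have := hϑ.length_eq_add_one hc hp h'
      omega
    · exact h'
  have hdescent : ∀ j (w : extAffineWeyl P c),
      length b c (simpleRefl b ϑ c j * w : extAffineWeyl P c) < length b c w →
        simpleRoot b ϑ c j ((w : V ≃ᵃ[ℝ] V) p) < 0 := fun j w h => by
    rcases (apply_ne_zero hp w (hsimple j)).lt_or_gt with h' | h'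
    · exact h'
    · have := hϑ.length_simpleRefl_mul hc hp h'
      omega
  refine ⟨?_, fun w => ?_, simpleRefl_mul_self b ϑ c, fun j w => ?_, fun w hw => ?_,
    fun u w hu => ?_, fun j k w h1 h2 => ?_⟩
  · rw [length_eq_zero_iff hc hp]
    exact fun a ha => (hp a ha).le
  · exact length_inv b c w
  · rcases (apply_ne_zero hp w (hsimple j)).lt_or_gt with h | h
    · exact Or.inr (hϑ.length_eq_add_one hc hp h)
    · exact Or.inl (hϑ.length_simpleRefl_mul hc hp h)
  · by_contra! hcon
    refine hw ((length_eq_zero_iff hc hp).2 fun a ha =>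
      hϑ.nonneg_of_forall_simpleRoot_nonneg (fun j => ?_) ha)
    rcases (apply_ne_zero hp w (hsimple j)).lt_or_gt with h | h
    · have := hϑ.length_eq_add_one hc hp h
      have := hcon j
      omega
    · exact h.le
  · simp only [length_eq_ncard hp (u * w), length_eq_ncard hp w, coe_mul_apply]
    rw [negRoots_of_length_eq_zero hc hu, Set.ncard_image_of_injective _ (comp_injective _)]
  · refine simpleRefl_mul_eq ?_
    by_contra hne
    have h3 := (comp_mem_posAffRoots_iff hp w (hsimple j)).2 (hascent j w h1).le
    have h4 := hp _ (hϑ.comp_simpleRefl_mem h3 hne)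
    have h5 := hdescent j (w * simpleRefl b ϑ c k) h2
    rw [coe_mul_apply] at h5
    exact absurd h4 (not_lt.2 h5.le)

end Crossings

/-! ### The weight `δ` -/

section Weight

variable {ι V N : Type*} [Fintype ι] [AddCommGroup V] [Module ℝ V] [AddCommGroup N] [Module ℝ N]
  {P : RootPairing ι ℝ V N} [P.IsRootSystem] [P.IsCrystallographic] {b : P.Base} {ϑ : ι}
  {c : ℕ} {p : V} {τ : extAffineWeyl P c → ℝ}

/-- `w` carries `x` into the fundamental alcove without crossing any wall that does not separate
them: the inversions of `w` are exactly the walls separating `x` from the fundamental alcove. -/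
def IsDirect (b : P.Base) (x : V) (w : extAffineWeyl P c) : Prop :=
  inversions b c w = negRoots b c x

theorem isDirect_iff (hp : ∀ a ∈ posAffRoots b c, 0 < a p) {x : V} {w : extAffineWeyl P c} :
    IsDirect b x w ↔
      negRoots b c (((w⁻¹ : extAffineWeyl P c) : V ≃ᵃ[ℝ] V) p) = negRoots b c x := by
  rw [IsDirect, inversions_eq_negRoots hp]

theorem IsDirect.apply_mem_alcove (hc : 0 < c) {x : V} {w : extAffineWeyl P c}
    (h : IsDirect b x w) : (w : V ≃ᵃ[ℝ] V) x ∈ alcove b c := by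
  obtain ⟨p, hp⟩ := exists_forall_posAffRoots_pos b hc
  rw [isDirect_iff hp] at h
  intro a ha
  by_contra! hneg
  rcases comp_mem_or_neg_mem w ha with h1 | h1
  · have h2 : a ∘ (w : V ≃ᵃ[ℝ] V) ∈ negRoots b c x := ⟨h1, hneg⟩
    rw [← h] at h2
    have h3 := h2.2
    rw [Function.comp_apply, apply_inv_apply] at h3
    exact absurd (hp a ha) (not_lt.2 h3.le)
  · have h2 : -(a ∘ (w : V ≃ᵃ[ℝ] V)) ∈
        negRoots b c (((w⁻¹ : extAffineWeyl P c) : V ≃ᵃ[ℝ] V) p) := by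
      refine ⟨h1, ?_⟩
      rw [Pi.neg_apply, Function.comp_apply, apply_inv_apply]
      linarith [hp a ha]
    rw [h] at h2
    have h3 := h2.2
    rw [Pi.neg_apply, Function.comp_apply] at h3
    linarith

/-- Two direct elements for the same point differ by an element of length zero. -/
theorem IsDirect.tau_eq (hc : 0 < c) (hτ : IsLengthMultiplicative b c τ) {x : V}
    {w w' : extAffineWeyl P c} (h : IsDirect b x w) (h' : IsDirect b x w') : τ w' = τ w := by
  obtain ⟨p, hp⟩ := exists_forall_posAffRoots_pos b hc
  have hu : length b c (w' * w⁻¹ : extAffineWeyl P c) = 0 := by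
    rw [length_eq_zero_iff hc hp, coe_mul_apply]
    refine IsDirect.apply_mem_alcove hc ?_
    rw [IsDirect, h', ← h, inversions_eq_negRoots hp]
  have hlen : length b c (w' : extAffineWeyl P c) = length b c w := by
    rw [length, length, h', h]
  have h1 := hτ.map_mul (w' * w⁻¹) w (by rw [inv_mul_cancel_right, hu, hlen, zero_add])
  rwa [inv_mul_cancel_right, hτ.map_length_zero _ hu, one_mul] at h1

theorem IsHighestShortRoot.isDirect_mul_simpleRefl [P.IsReduced] (hϑ : IsHighestShortRoot b ϑ)
    (hc : 0 < c) {j : Option b.support} {x : V} {w : extAffineWeyl P c} (h : IsDirect b x w)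
    (hx : 0 < simpleRoot b ϑ c j x) :
    IsDirect b ((simpleRefl b ϑ c j : V ≃ᵃ[ℝ] V) x) (w * simpleRefl b ϑ c j) ∧
      length b c (w * simpleRefl b ϑ c j : extAffineWeyl P c) = length b c w + 1 := by
  obtain ⟨p, hp⟩ := exists_forall_posAffRoots_pos b hc
  rw [isDirect_iff hp] at h
  have h1 : 0 < simpleRoot b ϑ c j (((w⁻¹ : extAffineWeyl P c) : V ≃ᵃ[ℝ] V) p) := by
    refine lt_of_le_of_ne (not_lt.1 fun h2 => ?_)
      (apply_ne_zero hp w⁻¹ (simpleRoot_mem_posAffRoots b ϑ c j)).symm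
    have h3 : simpleRoot b ϑ c j ∈ negRoots b c (((w⁻¹ : extAffineWeyl P c) : V ≃ᵃ[ℝ] V) p) :=
      ⟨simpleRoot_mem_posAffRoots b ϑ c j, h2⟩
    rw [h] at h3
    exact absurd hx (not_lt.2 h3.2.le)
  have h2 : (w * simpleRefl b ϑ c j)⁻¹ = simpleRefl b ϑ c j * w⁻¹ := by
    rw [mul_inv_rev, simpleRefl_inv]
  constructor
  · rw [isDirect_iff hp, h2, coe_mul_apply, hϑ.negRoots_simpleRefl h1, hϑ.negRoots_simpleRefl hx, h]
  · rw [← length_inv, ← Subgroup.coe_inv, h2, hϑ.length_simpleRefl_mul hc hp h1, Subgroup.coe_inv,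
      length_inv]

theorem IsDirect.mul_inv_of_length_eq_zero (hc : 0 < c) {u : extAffineWeyl P c}
    (hu : length b c u = 0) {x : V} {w : extAffineWeyl P c} (h : IsDirect b x w) :
    IsDirect b ((u : V ≃ᵃ[ℝ] V) x) (w * u⁻¹) := by
  obtain ⟨p, hp⟩ := exists_forall_posAffRoots_pos b hc
  rw [isDirect_iff hp] at h ⊢
  rw [mul_inv_rev, inv_inv, coe_mul_apply, negRoots_of_length_eq_zero hc hu,
    negRoots_of_length_eq_zero hc hu, h]

/-- Every point can be folded into the fundamental alcove by simple reflections, each of which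
removes a separating wall. -/
theorem IsHighestShortRoot.exists_isDirect [P.IsReduced] [P.IsIrreducible]
    (hϑ : IsHighestShortRoot b ϑ) (hc : 0 < c) (x : V) :
    ∃ w : extAffineWeyl P c, (w : V ≃ᵃ[ℝ] V) ∈ affineWeyl P c ∧ IsDirect b x w := by
  obtain ⟨p, hp⟩ := exists_forall_posAffRoots_pos b hc
  induction hn : (negRoots b c x).ncard generalizing x with
  | zero =>
    refine ⟨1, one_mem _, (isDirect_iff hp).2 ?_⟩
    rw [(Set.ncard_eq_zero (finite_negRoots b hc _)).1 hn, inv_one, negRoots_eq_empty_iff]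
    exact fun a ha => (hp a ha).le
  | succ n ih =>
    obtain ⟨j, hj⟩ : ∃ j, simpleRoot b ϑ c j x < 0 := by
      by_contra! hcon
      have h0 : negRoots b c x = ∅ := negRoots_eq_empty_iff.2 fun a ha =>
        hϑ.nonneg_of_forall_simpleRoot_nonneg hcon ha
      rw [h0, Set.ncard_empty] at hn
      omega
    set y := (simpleRefl b ϑ c j : V ≃ᵃ[ℝ] V) x with hy
    have hyx : (simpleRefl b ϑ c j : V ≃ᵃ[ℝ] V) y = x := by
      rw [hy, ← coe_mul_apply, simpleRefl_mul_self]
      rfl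
    have hypos : 0 < simpleRoot b ϑ c j y := by
      rw [hy, simpleRoot_simpleRefl]
      linarith
    have hcard := hϑ.ncard_negRoots_simpleRefl hc hypos
    rw [hyx, hn] at hcard
    obtain ⟨w, hw1, hw2⟩ := ih y (by omega)
    refine ⟨w * simpleRefl b ϑ c j, mul_mem hw1 (simpleRefl_mem_affineWeyl b ϑ c j), ?_⟩
    have := (hϑ.isDirect_mul_simpleRefl hc hw2 hypos).1
    rwa [hyx] at this

theorem affineWeyl_le_extAffineWeyl (P : RootPairing ι ℝ V N) [P.IsCrystallographic] (c : ℕ) :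
    affineWeyl P c ≤ extAffineWeyl P c := by
  rw [affineWeyl, Subgroup.closure_le]
  rintro g ⟨i, r, rfl⟩
  exact affRefl_mem P c i r

theorem negRoots_subset_inversions {x : V} {v : extAffineWeyl P c}
    (hv : (v : V ≃ᵃ[ℝ] V) x ∈ alcove b c) : negRoots b c x ⊆ inversions b c v := by
  rintro a ⟨h1, h2⟩
  refine ⟨h1, (comp_mem_or_neg_mem v⁻¹ h1).resolve_left fun h => ?_⟩
  have h3 := hv _ h
  rw [Function.comp_apply, inv_apply_apply] at h3
  linarith

theorem finite_inversions (hc : 0 < c) (w : extAffineWeyl P c) : (inversions b c w).Finite := by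
  obtain ⟨p, hp⟩ := exists_forall_posAffRoots_pos b hc
  rw [inversions_eq_negRoots hp]
  exact finite_negRoots b hc _

theorem IsHighestShortRoot.isDirect_shortest [P.IsReduced] [P.IsIrreducible]
    (hϑ : IsHighestShortRoot b ϑ) (hc : 0 < c) (x : V) : IsDirect b x (shortest b c x) := by
  obtain ⟨w, hw1, hw2⟩ := hϑ.exists_isDirect hc x
  have hlen : ∀ v : extAffineWeyl P c, (v : V ≃ᵃ[ℝ] V) x ∈ alcove b c →
      length b c w ≤ length b c v := fun v hv => by
    rw [length, hw2]
    exact Set.ncard_le_ncard (negRoots_subset_inversions hv) (finite_inversions hc v)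
  have hex : ∃ w : extAffineWeyl P c, IsShortestToAlcove b c x w :=
    ⟨w, hw1, hw2.apply_mem_alcove hc, fun v hv hvx =>
      hlen ⟨v, affineWeyl_le_extAffineWeyl P c hv⟩ hvx⟩
  obtain ⟨-, h2, h3⟩ := Classical.epsilon_spec hex
  refine (Set.eq_of_subset_of_ncard_le (negRoots_subset_inversions h2) ?_
    (finite_inversions hc _)).symm
  rw [← hw2]
  exact h3 w hw1 (hw2.apply_mem_alcove hc)

theorem delta_of_length_eq_zero [P.IsReduced] [P.IsIrreducible] (hϑ : IsHighestShortRoot b ϑ)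
    (hc : 0 < c) (hτ : IsLengthMultiplicative b c τ) {u : extAffineWeyl P c}
    (hu : length b c u = 0) (x : weightLattice P) : delta b c τ (u • x) = delta b c τ x := by
  have h1 := hϑ.isDirect_shortest hc (x : V)
  have h2 := hϑ.isDirect_shortest hc ((u • x : weightLattice P) : V)
  have h3 := (h1.mul_inv_of_length_eq_zero hc hu).tau_eq hc hτ h2
  have hS := hϑ.isLengthSystem hc
  have hu' : length b c (u⁻¹ : extAffineWeyl P c) = 0 := (hS.length_inv u).trans hu
  have hlen : length b c (shortest b c (x : V) * u⁻¹ : extAffineWeyl P c) =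
      length b c (shortest b c (x : V)) := by
    have h4 := hS.length_mul_of_eq_zero u (shortest b c (x : V))⁻¹ hu
    have h5 := hS.length_inv (u * (shortest b c (x : V))⁻¹)
    have h6 := hS.length_inv (shortest b c (x : V))
    rw [mul_inv_rev, inv_inv] at h5
    exact h5.trans (h4.trans h6)
  rw [delta, delta, h3, hτ.map_mul _ _ (by rw [hlen, hu', add_zero]), hτ.map_length_zero _ hu',
    mul_one]

theorem length_simpleRefl [P.IsReduced] (hϑ : IsHighestShortRoot b ϑ) (hc : 0 < c)
    (j : Option b.support) : length b c (simpleRefl b ϑ c j) = 1 := by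
  obtain ⟨p, hp⟩ := exists_forall_posAffRoots_pos b hc
  have h := hϑ.length_simpleRefl_mul hc hp (w := 1) (hp _ (simpleRoot_mem_posAffRoots b ϑ c j))
  rwa [mul_one, (length_eq_zero_iff hc hp (w := 1)).2 (fun a ha => (hp a ha).le)] at h

/-- Crossing the wall of `a_j` away from the fundamental alcove multiplies `δ` by `τ_j²`. -/
theorem delta_simpleRefl [P.IsReduced] [P.IsIrreducible] (hϑ : IsHighestShortRoot b ϑ)
    (hc : 0 < c) (hτ : IsLengthMultiplicative b c τ) {j : Option b.support} {x : weightLattice P}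
    (hx : 0 < simpleRoot b ϑ c j x) :
    delta b c τ (simpleRefl b ϑ c j • x) = τ (simpleRefl b ϑ c j) ^ 2 * delta b c τ x := by
  have h1 := hϑ.isDirect_shortest hc (x : V)
  have h2 := hϑ.isDirect_shortest hc ((simpleRefl b ϑ c j • x : weightLattice P) : V)
  obtain ⟨h3, h4⟩ := hϑ.isDirect_mul_simpleRefl hc h1 hx
  have h5 := h3.tau_eq hc hτ h2
  rw [delta, delta, h5, hτ.map_mul _ _ (by rw [h4, length_simpleRefl hϑ hc])]
  ring

end Weight

/-! ### Commuting left and right Hecke operators on functions on the group -/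

namespace IsLengthSystem

variable {W J : Type*} [Group W] {ℓ : W → ℕ} {s : J → W}

theorem simple_mul_cancel_left (hS : IsLengthSystem ℓ s) (j : J) (w : W) : s j * (s j * w) = w := by
  rw [← mul_assoc, hS.simple_mul_self, one_mul]

theorem mul_simple_cancel_right (hS : IsLengthSystem ℓ s) (j : J) (w : W) : w * s j * s j = w := by
  rw [mul_assoc, hS.simple_mul_self, mul_one]

theorem simple_inv (hS : IsLengthSystem ℓ s) (j : J) : (s j)⁻¹ = s j :=
  inv_eq_of_mul_eq_one_right (hS.simple_mul_self j)

theorem length_inv_mul (hS : IsLengthSystem ℓ s) (v w : W) : ℓ (w⁻¹ * v⁻¹) = ℓ (v * w) := by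
  rw [← mul_inv_rev, hS.length_inv]

theorem length_mul_simple (hS : IsLengthSystem ℓ s) (j : J) (w : W) :
    ℓ (w * s j) = ℓ w + 1 ∨ ℓ w = ℓ (w * s j) + 1 := by
  have h := hS.length_simple_mul j w⁻¹
  rwa [← hS.simple_inv, hS.length_inv_mul, hS.length_inv] at h

theorem length_mul_of_eq_zero_right (hS : IsLengthSystem ℓ s) {u : W} (hu : ℓ u = 0) (w : W) :
    ℓ (w * u) = ℓ w := by
  rw [← hS.length_inv_mul, hS.length_mul_of_eq_zero _ _ (by rw [hS.length_inv, hu]), hS.length_inv]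

theorem length_simple (hS : IsLengthSystem ℓ s) (j : J) : ℓ (s j) = 1 := by
  have h := hS.length_simple_mul j 1
  rw [mul_one, hS.length_one] at h
  omega

/-- Every element is a reduced product of simple reflections and an element of length zero. -/
theorem induction (hS : IsLengthSystem ℓ s) {motive : W → Prop}
    (zero : ∀ u, ℓ u = 0 → motive u)
    (simple_mul : ∀ j w, ℓ (s j * w) = ℓ w + 1 → motive w → motive (s j * w)) (w : W) :
    motive w := by
  induction hn : ℓ w using Nat.strong_induction_on generalizing w with
  | _ n ih =>
    by_cases h0 : ℓ w = 0
    · exact zero w h0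
    · obtain ⟨j, hj⟩ := hS.exists_descent w h0
      have h1 := simple_mul j (s j * w) (by
        rw [hS.simple_mul_cancel_left]
        have := hS.length_simple_mul j w
        omega) (ih _ (hn ▸ hj) _ rfl)
      rwa [hS.simple_mul_cancel_left] at h1

theorem length_mul_le (hS : IsLengthSystem ℓ s) (v w : W) : ℓ (v * w) ≤ ℓ v + ℓ w := by
  induction v using hS.induction with
  | zero u hu => rw [hS.length_mul_of_eq_zero u w hu]; omega
  | simple_mul j v hv ih =>
    have := hS.length_simple_mul j (v * w)
    rw [mul_assoc]
    omega

theorem lt_iff_of_ne (hS : IsLengthSystem ℓ s) {j k : J} {w : W} (h : s j * w ≠ w * s k) :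
    (ℓ w < ℓ (s j * w) ↔ ℓ (w * s k) < ℓ (s j * (w * s k))) := by
  have h1 := hS.length_simple_mul j w
  have h2 := hS.length_simple_mul j (w * s k)
  constructor
  · intro h3
    by_contra h4
    exact h (hS.folding j k w h3 (by omega))
  · intro h3
    by_contra h4
    have h5 := hS.folding j k (w * s k) h3 (by rw [hS.mul_simple_cancel_right]; omega)
    rw [hS.mul_simple_cancel_right, ← mul_assoc] at h5
    exact h (by rw [← h5, hS.mul_simple_cancel_right, h5])

end IsLengthSystem

section RegularRepresentation

variable {W J : Type*} [Group W]

open Classical in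
/-- The left Hecke operator of a simple reflection on functions on `W`, with parameter `z`. -/
noncomputable def leftHecke (ℓ : W → ℕ) (r : W) (z : ℂ) : Module.End ℂ (W → ℂ) where
  toFun F w := if ℓ w < ℓ (r * w) then z * F (r * w) else z⁻¹ * F (r * w) + (z - z⁻¹) * F w
  map_add' F G := by
    ext w
    simp only [Pi.add_apply]
    split_ifs <;> ring
  map_smul' a F := by
    ext w
    simp only [Pi.smul_apply, smul_eq_mul, RingHom.id_apply]
    split_ifs <;> ring

open Classical in
/-- The right Hecke operator of a simple reflection on functions on `W`, with parameter `z`. -/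
noncomputable def rightHecke (ℓ : W → ℕ) (r : W) (z : ℂ) : Module.End ℂ (W → ℂ) where
  toFun F w := if ℓ w < ℓ (w * r) then z * F (w * r) else z⁻¹ * F (w * r) + (z - z⁻¹) * F w
  map_add' F G := by
    ext w
    simp only [Pi.add_apply]
    split_ifs <;> ring
  map_smul' a F := by
    ext w
    simp only [Pi.smul_apply, smul_eq_mul, RingHom.id_apply]
    split_ifs <;> ring

/-- Translation of functions on a `W`-set `X`: `(wf)(x) = f(w⁻¹x)`. -/
def translate (X : Type*) [MulAction W X] (w : W) : Module.End ℂ (X → ℂ) where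
  toFun f x := f (w⁻¹ • x)
  map_add' _ _ := rfl
  map_smul' _ _ := rfl

/-- Right translation of functions on `W`. -/
def rightTranslate (u : W) : Module.End ℂ (W → ℂ) where
  toFun F w := F (w * u)
  map_add' _ _ := rfl
  map_smul' _ _ := rfl

variable {ℓ : W → ℕ} {s : J → W} {t : W → ℂ}

/-- An operator on functions on `W` that commutes with the right Hecke operators and with right
translation by elements of length zero. -/
structure IsRightEquivariant (ℓ : W → ℕ) (s : J → W) (t : W → ℂ) (A : Module.End ℂ (W → ℂ)) :
    Prop where
  hecke : ∀ k F, A (rightHecke ℓ (s k) (t (s k)) F) = rightHecke ℓ (s k) (t (s k)) (A F)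
  translate : ∀ u, ℓ u = 0 → ∀ F, A (rightTranslate u F) = rightTranslate u (A F)

theorem isRightEquivariant_leftHecke (hS : IsLengthSystem ℓ s)
    (ht : ∀ w w', ℓ (w * w') = ℓ w + ℓ w' → t (w * w') = t w * t w') (ht0 : ∀ w, t w ≠ 0)
    (j : J) : IsRightEquivariant ℓ s t (leftHecke ℓ (s j) (t (s j))) := by
  constructor
  · intro k F
    ext w
    by_cases h : s j * w = w * s k
    · have htjk : t (s j) = t (s k) := by
        have key : ∀ w, s j * w = w * s k → ℓ (s j * w) = ℓ w + 1 → t (s j) = t (s k) := by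
          intro w h h1
          have h2 := ht (s j) w (by rw [h1, hS.length_simple, add_comm])
          rw [h, ht w (s k) (by rw [← h, h1, hS.length_simple]), mul_comm] at h2
          exact (mul_right_cancel₀ (ht0 w) h2).symm
        rcases hS.length_simple_mul j w with h1 | h1
        · exact key w h h1
        · refine key (s j * w) (by rw [hS.simple_mul_cancel_left, h, hS.mul_simple_cancel_right]) ?_
          rw [hS.simple_mul_cancel_left, h1]
      have hww : s j * (w * s k) = w := by rw [← h, hS.simple_mul_cancel_left]
      simp only [leftHecke, rightHecke, LinearMap.coe_mk, AddHom.coe_mk, htjk, h, hww,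
        hS.mul_simple_cancel_right]
    · have h1 := hS.lt_iff_of_ne h
      have h2 := hS.length_simple_mul j w
      have h3 := hS.length_simple_mul j (w * s k)
      have h4 := hS.length_mul_simple k w
      have h5 := hS.length_mul_simple k (s j * w)
      have h6 : ℓ w < ℓ (w * s k) ↔ ℓ (s j * w) < ℓ (s j * (w * s k)) := by
        rw [mul_assoc] at h5
        omega
      simp only [leftHecke, rightHecke, LinearMap.coe_mk, AddHom.coe_mk, mul_assoc, ← h1, ← h6]
      split_ifs <;> ring
  · intro u hu F
    ext w
    simp only [leftHecke, rightTranslate, LinearMap.coe_mk, AddHom.coe_mk, ← mul_assoc,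
      hS.length_mul_of_eq_zero_right hu]

theorem isRightEquivariant_translate (hS : IsLengthSystem ℓ s) {u : W} (hu : ℓ u = 0) :
    IsRightEquivariant ℓ s t (translate W u) := by
  have hu' : ℓ u⁻¹ = 0 := by rw [hS.length_inv, hu]
  constructor
  · intro k F
    ext w
    simp only [translate, rightHecke, LinearMap.coe_mk, AddHom.coe_mk, smul_eq_mul, ← mul_assoc]
    simp only [mul_assoc, hS.length_mul_of_eq_zero _ _ hu']
  · intro v hv F
    ext w
    simp only [translate, rightTranslate, LinearMap.coe_mk, AddHom.coe_mk, smul_eq_mul, mul_assoc]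

theorem IsRightEquivariant.mul {A A' : Module.End ℂ (W → ℂ)} (h : IsRightEquivariant ℓ s t A)
    (h' : IsRightEquivariant ℓ s t A') : IsRightEquivariant ℓ s t (A * A') :=
  ⟨fun k F => by rw [Module.End.mul_apply, h'.hecke, h.hecke, Module.End.mul_apply],
    fun u hu F => by rw [Module.End.mul_apply, h'.translate u hu, h.translate u hu,
      Module.End.mul_apply]⟩

/-- A right equivariant operator is determined by its values at the unit element, as the right
operators move the unit element to any other. -/
theorem IsRightEquivariant.ext (hS : IsLengthSystem ℓ s) (ht0 : ∀ w, t w ≠ 0)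
    {A A' : Module.End ℂ (W → ℂ)} (h : IsRightEquivariant ℓ s t A)
    (h' : IsRightEquivariant ℓ s t A') (h1 : ∀ F, A F 1 = A' F 1) : A = A' := by
  suffices H : ∀ w F, A F w⁻¹ = A' F w⁻¹ by
    refine LinearMap.ext fun F => funext fun w => ?_
    simpa using H w⁻¹ F
  intro w
  induction w using hS.induction with
  | zero u hu =>
    intro F
    have hu' : ℓ u⁻¹ = 0 := by rw [hS.length_inv, hu]
    have h2 : ∀ G : W → ℂ, G u⁻¹ = rightTranslate u⁻¹ G 1 := fun G => by simp [rightTranslate]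
    rw [h2 (A F), h2 (A' F), ← h.translate _ hu', ← h'.translate _ hu', h1]
  | simple_mul j w hw ih =>
    intro F
    have h2 : ∀ G : W → ℂ, t (s j) * G (s j * w)⁻¹ = rightHecke ℓ (s j) (t (s j)) G w⁻¹ := by
      intro G
      simp only [rightHecke, LinearMap.coe_mk, AddHom.coe_mk]
      rw [mul_inv_rev, hS.simple_inv, if_pos]
      have h3 := hS.length_inv_mul (s j) w
      rw [hS.simple_inv, hw] at h3
      rw [h3, hS.length_inv]
      exact Nat.lt_succ_self _
    refine mul_left_cancel₀ (ht0 (s j)) ?_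
    rw [h2, h2, ← h.hecke, ← h'.hecke, ih]

variable {X : Type*} [MulAction W X]

/-- `B` is an operator for `T_w` on functions on the `W`-set `X`: on every orbit through a point of
`D` it is modelled by a right equivariant operator `A` on functions on `W` that acts at `1` as
`τ_w` times evaluation at `w⁻¹`. -/
structure IsHeckeOperator (ℓ : W → ℕ) (s : J → W) (t : W → ℂ) (D : Set X) (w : W)
    (A : Module.End ℂ (W → ℂ)) (B : Module.End ℂ (X → ℂ)) : Prop where
  equivariant : IsRightEquivariant ℓ s t A
  orbit : ∀ x ∈ D, ∀ f v, B f (v • x) = A (fun v => f (v • x)) v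
  apply : ∀ F v, ℓ (w⁻¹ * v) = ℓ w + ℓ v → A F v = t w * F (w⁻¹ * v)

theorem IsHeckeOperator.mul (hS : IsLengthSystem ℓ s)
    (ht : ∀ w w', ℓ (w * w') = ℓ w + ℓ w' → t (w * w') = t w * t w') {D : Set X} {w w' : W}
    {A A' : Module.End ℂ (W → ℂ)} {B B' : Module.End ℂ (X → ℂ)}
    (h : IsHeckeOperator ℓ s t D w A B) (h' : IsHeckeOperator ℓ s t D w' A' B')
    (hl : ℓ (w * w') = ℓ w + ℓ w') : IsHeckeOperator ℓ s t D (w * w') (A * A') (B * B') := by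
  refine ⟨h.equivariant.mul h'.equivariant, fun x hx f v => ?_, fun F v hv => ?_⟩
  · rw [Module.End.mul_apply, h.orbit x hx, Module.End.mul_apply]
    exact congrFun (congrArg A (funext fun v => h'.orbit x hx f v)) v
  · rw [mul_inv_rev, mul_assoc] at hv ⊢
    have h1 := hS.length_mul_le w'⁻¹ (w⁻¹ * v)
    have h2 := hS.length_mul_le w⁻¹ v
    rw [hS.length_inv] at h1 h2
    rw [Module.End.mul_apply, h.apply _ _ (by omega), h'.apply _ _ (by omega), ht w w' hl,
      mul_assoc]

theorem IsHeckeOperator.unique (hS : IsLengthSystem ℓ s) (ht0 : ∀ w, t w ≠ 0) {D : Set X}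
    (hD : ∀ x : X, ∃ w : W, ∃ y ∈ D, x = w • y) {w : W}
    {A A' : Module.End ℂ (W → ℂ)} {B B' : Module.End ℂ (X → ℂ)}
    (h : IsHeckeOperator ℓ s t D w A B) (h' : IsHeckeOperator ℓ s t D w A' B') : B = B' := by
  have hA : A = A' := h.equivariant.ext hS ht0 h'.equivariant fun F => by
    have hl : ℓ (w⁻¹ * 1) = ℓ w + ℓ 1 := by rw [mul_one, hS.length_inv, hS.length_one, add_zero]
    rw [h.apply F 1 hl, h'.apply F 1 hl]
  refine LinearMap.ext fun f => funext fun x => ?_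
  obtain ⟨v, y, hy, rfl⟩ := hD x
  rw [h.orbit y hy, h'.orbit y hy, hA]

theorem isHeckeOperator_translate (hS : IsLengthSystem ℓ s) (htz : ∀ w, ℓ w = 0 → t w = 1)
    (D : Set X) {u : W} (hu : ℓ u = 0) :
    IsHeckeOperator ℓ s t D u (translate W u) (translate X u) :=
  ⟨isRightEquivariant_translate hS hu, fun x _ f v => by simp [translate, mul_smul],
    fun F v _ => by simp [translate, htz u hu]⟩

/-- Operators on functions on `X` that look like the left Hecke operators along orbits extend to a
family of operators `T_w`, `w ∈ W`, that is multiplicative as far as lengths add up. -/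
theorem exists_multiplicative_family (hS : IsLengthSystem ℓ s)
    (ht : ∀ w w', ℓ (w * w') = ℓ w + ℓ w' → t (w * w') = t w * t w') (ht0 : ∀ w, t w ≠ 0)
    (htz : ∀ w, ℓ w = 0 → t w = 1) {D : Set X} (hD : ∀ x : X, ∃ w : W, ∃ y ∈ D, x = w • y)
    (B : J → Module.End ℂ (X → ℂ)) (hB : ∀ j, ∀ x ∈ D, ∀ f v,
      B j f (v • x) = leftHecke ℓ (s j) (t (s j)) (fun v => f (v • x)) v) :
    ∃ T : W → Module.End ℂ (X → ℂ), (∀ j, T (s j) = B j) ∧ (∀ u, ℓ u = 0 → T u = translate X u) ∧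
      ∀ w w', ℓ (w * w') = ℓ w + ℓ w' → T (w * w') = T w * T w' := by
  have hsimple : ∀ j, IsHeckeOperator ℓ s t D (s j) (leftHecke ℓ (s j) (t (s j))) (B j) := by
    refine fun j => ⟨isRightEquivariant_leftHecke hS ht ht0 j, hB j, fun F v hv => ?_⟩
    rw [hS.simple_inv, hS.length_simple] at hv
    simp only [leftHecke, LinearMap.coe_mk, AddHom.coe_mk]
    rw [if_pos (by omega), hS.simple_inv]
  have hex : ∀ w, ∃ AB : Module.End ℂ (W → ℂ) × Module.End ℂ (X → ℂ),
      IsHeckeOperator ℓ s t D w AB.1 AB.2 := by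
    intro w
    induction w using hS.induction with
    | zero u hu => exact ⟨(_, _), isHeckeOperator_translate hS htz D hu⟩
    | simple_mul j w hw ih =>
      obtain ⟨AB, hAB⟩ := ih
      exact ⟨(_, _), (hsimple j).mul hS ht hAB (by rw [hw, hS.length_simple, add_comm])⟩
  choose AB hAB using hex
  exact ⟨fun w => (AB w).2, fun j => (hAB _).unique hS ht0 hD (hsimple j),
    fun u hu => (hAB u).unique hS ht0 hD (isHeckeOperator_translate hS htz D hu),
    fun w w' hl => (hAB _).unique hS ht0 hD ((hAB w).mul hS ht (hAB w') hl)⟩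

end RegularRepresentation

/-! ### The difference-reflection representation -/

section DifferenceReflection

variable {ι V N : Type*} [Fintype ι] [AddCommGroup V] [Module ℝ V] [AddCommGroup N] [Module ℝ N]
  {P : RootPairing ι ℝ V N} [P.IsRootSystem] [P.IsCrystallographic] {b : P.Base} {ϑ : ι}
  {c : ℕ} {τ : extAffineWeyl P c → ℝ}

theorem coe_smul (w : extAffineWeyl P c) (x : weightLattice P) :
    ((w • x : weightLattice P) : V) = (w : V ≃ᵃ[ℝ] V) x := rfl

theorem simpleRoot_smul (b : P.Base) (ϑ : ι) (j : Option b.support) (x : weightLattice P) :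
    simpleRoot b ϑ c j ((simpleRefl b ϑ c j • x : weightLattice P) : V) =
      -simpleRoot b ϑ c j (x : V) :=
  simpleRoot_simpleRefl b ϑ c j x

theorem simpleRefl_smul_of_eq_zero {j : Option b.support} {x : weightLattice P}
    (hx : simpleRoot b ϑ c j (x : V) = 0) : simpleRefl b ϑ c j • x = x :=
  Subtype.ext (simpleRefl_apply_of_eq_zero hx)

theorem simpleRefl_smul_smul (b : P.Base) (ϑ : ι) (j : Option b.support) (x : weightLattice P) :
    simpleRefl b ϑ c j • simpleRefl b ϑ c j • x = x := by
  rw [← mul_smul, simpleRefl_mul_self, one_smul]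

theorem diffRefl_apply (b : P.Base) (ϑ : ι) (τ : extAffineWeyl P c → ℝ) (j : Option b.support)
    (f : weightLattice P → ℂ) (x : weightLattice P) :
    diffRefl b ϑ c τ j f x = (τ (simpleRefl b ϑ c j) : ℂ) * f x +
      (chi (τ (simpleRefl b ϑ c j)) (simpleRoot b ϑ c j x) : ℂ) *
        (f (simpleRefl b ϑ c j • x) - f x) := by
  have h : actOp c (simpleRefl b ϑ c j) f x = f ((simpleRefl b ϑ c j)⁻¹ • x) := rfl
  rw [simpleRefl_inv] at h
  rw [← h]
  rfl

theorem chi_of_pos {t y : ℝ} (h : 0 < y) : chi t y = t := if_pos h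

theorem chi_of_neg {t y : ℝ} (h : y < 0) : chi t y = t⁻¹ := by
  rw [chi, if_neg h.le.not_gt, if_neg h.ne]

/-- Along the orbit of a point of the fundamental alcove, the difference-reflection operators are
the left Hecke operators of the regular representation. -/
theorem IsHighestShortRoot.diffRefl_smul [P.IsReduced] [P.IsIrreducible]
    (hϑ : IsHighestShortRoot b ϑ) (hc : 0 < c) (j : Option b.support)
    {x : weightLattice P} (hx : (x : V) ∈ alcove b c) (f : weightLattice P → ℂ)
    (w : extAffineWeyl P c) :
    diffRefl b ϑ c τ j f (w • x) =
      leftHecke (fun w : extAffineWeyl P c => length b c w) (simpleRefl b ϑ c j)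
        (τ (simpleRefl b ϑ c j)) (fun v => f (v • x)) w := by
  obtain ⟨p, hp⟩ := exists_forall_posAffRoots_pos b hc
  have ha := simpleRoot_mem_posAffRoots b ϑ c j
  rw [diffRefl_apply]
  simp only [leftHecke, LinearMap.coe_mk, AddHom.coe_mk, mul_smul]
  by_cases h0 : simpleRoot b ϑ c j ((w • x : weightLattice P) : V) = 0
  · rw [simpleRefl_smul_of_eq_zero h0]
    split_ifs <;> ring
  rcases (apply_ne_zero hp w ha).lt_or_gt with h | h
  · have h1 := hϑ.length_eq_add_one hc hp h
    have h2 : simpleRoot b ϑ c j ((w • x : weightLattice P) : V) < 0 := by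
      refine lt_of_le_of_ne ?_ h0
      have h3 := (comp_mem_or_neg_mem w ha).resolve_left fun h3 =>
        absurd h (not_lt.2 ((comp_mem_posAffRoots_iff hp w ha).1 h3))
      have h4 := hx _ h3
      rw [Pi.neg_apply, Function.comp_apply] at h4
      rw [coe_smul]
      linarith
    rw [if_neg (by omega), chi_of_neg h2]
    push_cast
    ring
  · have h1 := hϑ.length_simpleRefl_mul hc hp h
    have h2 : 0 < simpleRoot b ϑ c j ((w • x : weightLattice P) : V) :=
      lt_of_le_of_ne (hx _ ((comp_mem_posAffRoots_iff hp w ha).2 h.le)) (Ne.symm h0)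
    rw [if_pos (by omega), chi_of_pos h2]
    ring

theorem diffRefl_quadratic (b : P.Base) (ϑ : ι) (j : Option b.support) :
    (diffRefl b ϑ c τ j - algebraMap ℂ _ (τ (simpleRefl b ϑ c j) : ℂ)) *
      (diffRefl b ϑ c τ j + algebraMap ℂ _ ((τ (simpleRefl b ϑ c j) : ℂ)⁻¹)) = 0 := by
  refine LinearMap.ext fun f => funext fun x => ?_
  rw [Module.End.mul_apply]
  set g := (diffRefl b ϑ c τ j + algebraMap ℂ _ ((τ (simpleRefl b ϑ c j) : ℂ)⁻¹)) f with hg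
  have hgx : ∀ x, g x = diffRefl b ϑ c τ j f x + (τ (simpleRefl b ϑ c j) : ℂ)⁻¹ * f x := by
    intro x
    simp [hg]
  have h : (diffRefl b ϑ c τ j - algebraMap ℂ _ (τ (simpleRefl b ϑ c j) : ℂ)) g x =
      diffRefl b ϑ c τ j g x - (τ (simpleRefl b ϑ c j) : ℂ) * g x := by
    simp
  rw [h, diffRefl_apply, hgx, hgx, diffRefl_apply, diffRefl_apply, simpleRoot_smul,
    simpleRefl_smul_smul]
  rcases lt_trichotomy (simpleRoot b ϑ c j (x : V)) 0 with h0 | h0 | h0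
  · rw [chi_of_neg h0, chi_of_pos (by linarith)]
    push_cast
    simp only [LinearMap.zero_apply, Pi.zero_apply]
    ring
  · rw [simpleRefl_smul_of_eq_zero h0]
    simp
  · rw [chi_of_pos h0, chi_of_neg (by linarith)]
    push_cast
    simp only [LinearMap.zero_apply, Pi.zero_apply]
    ring

theorem IsHighestShortRoot.exists_isDiffReflRep [P.IsReduced] [P.IsIrreducible]
    (hϑ : IsHighestShortRoot b ϑ) (hc : 0 < c) (hτ : IsLengthMultiplicative b c τ) :
    ∃ ρ : HeckeAlgebra b ϑ c τ →ₐ[ℂ] Module.End ℂ (weightLattice P → ℂ),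
      IsDiffReflRep b ϑ c τ ρ := by
  have hS := hϑ.isLengthSystem hc
  obtain ⟨T, hT1, hT2, hT3⟩ := exists_multiplicative_family hS
    (t := fun w : extAffineWeyl P c => (τ w : ℂ))
    (fun w w' h => by rw [hτ.map_mul w w' h]; push_cast; rfl)
    (fun w => by exact_mod_cast hτ.ne_zero w)
    (fun w h => by rw [hτ.map_length_zero w h]; simp)
    (D := {x : weightLattice P | (x : V) ∈ alcove b c})
    (fun x => by
      obtain ⟨w, -, hw⟩ := hϑ.exists_isDirect hc (x : V)
      exact ⟨w⁻¹, w • x, hw.apply_mem_alcove hc, by rw [inv_smul_smul]⟩)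
    (diffRefl b ϑ c τ) (fun j x hx f v => hϑ.diffRefl_smul hc j hx f v)
  have hrel : ∀ ⦃x y : FreeAlgebra ℂ (extAffineWeyl P c)⦄, HeckeRel b ϑ c τ x y →
      FreeAlgebra.lift ℂ T x = FreeAlgebra.lift ℂ T y := by
    intro x y h
    induction h with
    | one =>
      rw [FreeAlgebra.lift_ι_apply, map_one, hT2 1 hS.length_one]
      refine LinearMap.ext fun f => funext fun x => ?_
      change f ((1 : extAffineWeyl P c)⁻¹ • x) = f x
      rw [inv_one, one_smul]
    | mul w w' h =>
      rw [map_mul, FreeAlgebra.lift_ι_apply, FreeAlgebra.lift_ι_apply, FreeAlgebra.lift_ι_apply,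
        hT3 w w' h]
    | quad j =>
      rw [map_mul, map_sub, map_add, AlgHom.commutes, AlgHom.commutes, map_zero,
        FreeAlgebra.lift_ι_apply, hT1, diffRefl_quadratic]
  have hρ : ∀ w, RingQuot.liftAlgHom ℂ ⟨FreeAlgebra.lift ℂ T, hrel⟩ (heckeT b ϑ c τ w) = T w :=
    fun w => (RingQuot.liftAlgHom_mkAlgHom_apply ℂ _ hrel _).trans (FreeAlgebra.lift_ι_apply _ _)
  exact ⟨RingQuot.liftAlgHom ℂ ⟨FreeAlgebra.lift ℂ T, hrel⟩,
    fun j => (hρ _).trans (hT1 j), fun u hu => (hρ u).trans (hT2 u hu)⟩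

theorem heckeT_mul (b : P.Base) (ϑ : ι) (τ : extAffineWeyl P c → ℝ) {w w' : extAffineWeyl P c}
    (h : length b c (w * w' : extAffineWeyl P c) = length b c w + length b c w') :
    heckeT b ϑ c τ (w * w') = heckeT b ϑ c τ w * heckeT b ϑ c τ w' := by
  have h1 := heckeMk_rel b ϑ c τ (HeckeRel.mul w w' h)
  rw [map_mul] at h1
  exact h1.symm

/-- A property of elements of `H` that is stable under the algebra operations holds everywhere if
it holds for the `T_j` and the `T_u` with `ℓ(u) = 0`. -/
theorem IsHighestShortRoot.hecke_induction [P.IsReduced] [P.IsIrreducible]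
    (hϑ : IsHighestShortRoot b ϑ) (hc : 0 < c) {motive : HeckeAlgebra b ϑ c τ → Prop}
    (scalar : ∀ z : ℂ, motive (algebraMap ℂ _ z))
    (simple : ∀ j, motive (heckeT b ϑ c τ (simpleRefl b ϑ c j)))
    (omega : ∀ u : extAffineWeyl P c, length b c u = 0 → motive (heckeT b ϑ c τ u))
    (mul : ∀ x y, motive x → motive y → motive (x * y))
    (add : ∀ x y, motive x → motive y → motive (x + y)) (h : HeckeAlgebra b ϑ c τ) : motive h := by
  have hS := hϑ.isLengthSystem hc
  obtain ⟨x, rfl⟩ := heckeMk_surjective b ϑ c τ h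
  induction x using FreeAlgebra.induction with
  | grade0 z =>
    rw [AlgHom.commutes]
    exact scalar z
  | grade1 w =>
    change motive (heckeT b ϑ c τ w)
    induction w using hS.induction with
    | zero u hu => exact omega u hu
    | simple_mul j w hw ih =>
      have h1 : length b c (simpleRefl b ϑ c j) = 1 := hS.length_simple j
      rw [heckeT_mul b ϑ τ (by rw [hw, h1, add_comm])]
      exact mul _ _ (simple j) ih
  | mul x y hx hy =>
    rw [map_mul]
    exact mul _ _ hx hy
  | add x y hx hy =>
    rw [map_add]
    exact add _ _ hx hy

theorem IsHighestShortRoot.isDiffReflRep_unique [P.IsReduced] [P.IsIrreducible]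
    (hϑ : IsHighestShortRoot b ϑ) (hc : 0 < c)
    {ρ ρ' : HeckeAlgebra b ϑ c τ →ₐ[ℂ] Module.End ℂ (weightLattice P → ℂ)}
    (hρ : IsDiffReflRep b ϑ c τ ρ) (hρ' : IsDiffReflRep b ϑ c τ ρ') : ρ' = ρ := by
  refine AlgHom.ext fun h => ?_
  induction h using hϑ.hecke_induction hc with
  | scalar z => rw [AlgHom.commutes, AlgHom.commutes]
  | simple j => rw [hρ.simple, hρ'.simple]
  | omega u hu => rw [hρ.omega u hu, hρ'.omega u hu]
  | mul x y hx hy => rw [map_mul, map_mul, hx, hy]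
  | add x y hx hy => rw [map_add, map_add, hx, hy]

end DifferenceReflection

/-! ### Bounded operators on `l²(P, δ)` -/

section HilbertSpace

variable {ι V N : Type*} [Fintype ι] [AddCommGroup V] [Module ℝ V] [AddCommGroup N] [Module ℝ N]
  {P : RootPairing ι ℝ V N} [P.IsRootSystem] [P.IsCrystallographic] {b : P.Base} {ϑ : ι}
  {c : ℕ} {τ : extAffineWeyl P c → ℝ}

theorem mem_l2_iff {f : weightLattice P → ℂ} :
    f ∈ l2 b c τ ↔ Summable fun x => ‖f x‖ ^ 2 * delta b c τ x := Iff.rfl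

/-- The squared norm `⟨f, f⟩_δ`. -/
noncomputable def sqNorm (b : P.Base) (c : ℕ) (τ : extAffineWeyl P c → ℝ)
    (f : weightLattice P → ℂ) : ℝ := ∑' x, ‖f x‖ ^ 2 * delta b c τ x

theorem normDelta_eq_sqrt (f : weightLattice P → ℂ) :
    normDelta b c τ f = √(sqNorm b c τ f) := by
  have h : innerDelta b c τ f f = (sqNorm b c τ f : ℂ) := by
    rw [innerDelta, sqNorm, Complex.ofReal_tsum]
    refine tsum_congr fun x => ?_
    rw [Complex.mul_conj, Complex.normSq_eq_norm_sq]
    push_cast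
    rfl
  rw [normDelta, h, Complex.ofReal_re]

theorem summable_inner {f g : weightLattice P → ℂ} (hf : f ∈ l2 b c τ) (hg : g ∈ l2 b c τ) :
    Summable fun x => f x * conj (g x) * (delta b c τ x : ℂ) := by
  refine Summable.of_norm_bounded (hf.add hg) fun x => ?_
  have hδ := delta_nonneg b c τ x
  rw [norm_mul, norm_mul, RCLike.norm_conj, Complex.norm_real, Real.norm_of_nonneg hδ, ← add_mul]
  refine mul_le_mul_of_nonneg_right ?_ hδ
  nlinarith [sq_nonneg (‖f x‖ - ‖g x‖), sq_nonneg ‖f x‖, sq_nonneg ‖g x‖]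

theorem innerDelta_add_left {f f' g : weightLattice P → ℂ} (hf : f ∈ l2 b c τ)
    (hf' : f' ∈ l2 b c τ) (hg : g ∈ l2 b c τ) :
    innerDelta b c τ (f + f') g = innerDelta b c τ f g + innerDelta b c τ f' g := by
  rw [innerDelta, innerDelta, innerDelta,
    ← (summable_inner hf hg).tsum_add (summable_inner hf' hg)]
  refine tsum_congr fun x => ?_
  rw [Pi.add_apply]
  ring

theorem innerDelta_add_right {f g g' : weightLattice P → ℂ} (hf : f ∈ l2 b c τ)
    (hg : g ∈ l2 b c τ) (hg' : g' ∈ l2 b c τ) :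
    innerDelta b c τ f (g + g') = innerDelta b c τ f g + innerDelta b c τ f g' := by
  rw [innerDelta, innerDelta, innerDelta,
    ← (summable_inner hf hg).tsum_add (summable_inner hf hg')]
  refine tsum_congr fun x => ?_
  rw [Pi.add_apply, map_add]
  ring

/-- `B` restricts to a bounded operator on `l²(P, δ)`. -/
def IsBoundedOn (b : P.Base) (c : ℕ) (τ : extAffineWeyl P c → ℝ)
    (B : Module.End ℂ (weightLattice P → ℂ)) : Prop :=
  ∃ K : ℝ, 0 ≤ K ∧ ∀ f ∈ l2 b c τ, B f ∈ l2 b c τ ∧ sqNorm b c τ (B f) ≤ K * sqNorm b c τ f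

theorem IsBoundedOn.exists_normDelta_le {B : Module.End ℂ (weightLattice P → ℂ)}
    (h : IsBoundedOn b c τ B) : ∃ C : ℝ, ∀ f ∈ l2 b c τ, B f ∈ l2 b c τ ∧
      normDelta b c τ (B f) ≤ C * normDelta b c τ f := by
  obtain ⟨K, hK, h⟩ := h
  refine ⟨√K, fun f hf => ⟨(h f hf).1, ?_⟩⟩
  rw [normDelta_eq_sqrt, normDelta_eq_sqrt, ← Real.sqrt_mul hK]
  exact Real.sqrt_le_sqrt (h f hf).2

theorem isBoundedOn_algebraMap (z : ℂ) :
    IsBoundedOn b c τ (algebraMap ℂ (Module.End ℂ (weightLattice P → ℂ)) z) := by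
  refine ⟨‖z‖ ^ 2, sq_nonneg _, fun f hf => ⟨(l2 b c τ).smul_mem z hf, le_of_eq ?_⟩⟩
  rw [sqNorm, sqNorm, ← tsum_mul_left]
  refine tsum_congr fun x => ?_
  rw [Module.algebraMap_end_apply, Pi.smul_apply, smul_eq_mul, norm_mul]
  ring

theorem IsBoundedOn.mul {B B' : Module.End ℂ (weightLattice P → ℂ)} (h : IsBoundedOn b c τ B)
    (h' : IsBoundedOn b c τ B') : IsBoundedOn b c τ (B * B') := by
  obtain ⟨K, hK, h⟩ := h
  obtain ⟨K', hK', h'⟩ := h'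
  refine ⟨K * K', mul_nonneg hK hK', fun f hf => ⟨(h _ (h' f hf).1).1, ?_⟩⟩
  refine (h _ (h' f hf).1).2.trans ?_
  rw [mul_assoc]
  exact mul_le_mul_of_nonneg_left (h' f hf).2 hK

theorem IsBoundedOn.add {B B' : Module.End ℂ (weightLattice P → ℂ)} (h : IsBoundedOn b c τ B)
    (h' : IsBoundedOn b c τ B') : IsBoundedOn b c τ (B + B') := by
  obtain ⟨K, hK, h⟩ := h
  obtain ⟨K', hK', h'⟩ := h'
  refine ⟨2 * (K + K'), by positivity, fun f hf => ?_⟩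
  obtain ⟨h1, h2⟩ := h f hf
  obtain ⟨h3, h4⟩ := h' f hf
  have h5 : (B + B') f ∈ l2 b c τ := add_mem h1 h3
  refine ⟨h5, ?_⟩
  have h6 : sqNorm b c τ ((B + B') f) ≤ 2 * (sqNorm b c τ (B f) + sqNorm b c τ (B' f)) := by
    rw [sqNorm, sqNorm, sqNorm, ← h1.tsum_add h3, ← tsum_mul_left]
    refine h5.tsum_le_tsum (fun x => ?_) ((h1.add h3).mul_left 2)
    rw [LinearMap.add_apply, Pi.add_apply, ← add_mul, ← mul_assoc]
    refine mul_le_mul_of_nonneg_right ?_ (delta_nonneg b c τ x)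
    nlinarith [norm_add_le (B f x) (B' f x), norm_nonneg (B f x + B' f x),
      sq_nonneg (‖B f x‖ - ‖B' f x‖)]
  nlinarith

/-- Composition with a bijection `σ` of the weight lattice that distorts `δ` at most by a factor `K`
is bounded on `l²(P, δ)`. -/
theorem sqNorm_comp_le {σ : Equiv.Perm (weightLattice P)} {K : ℝ}
    (hσ : ∀ x, delta b c τ (σ.symm x) ≤ K * delta b c τ x) {f : weightLattice P → ℂ}
    (hf : f ∈ l2 b c τ) : f ∘ σ ∈ l2 b c τ ∧ sqNorm b c τ (f ∘ σ) ≤ K * sqNorm b c τ f := by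
  have h1 : Summable fun x => ‖f x‖ ^ 2 * delta b c τ (σ.symm x) := by
    refine Summable.of_nonneg_of_le (fun x => mul_nonneg (sq_nonneg _) (delta_nonneg b c τ _))
      (fun x => ?_) (Summable.mul_left K hf)
    nlinarith [mul_le_mul_of_nonneg_left (hσ x) (sq_nonneg ‖f x‖)]
  have h2 : (fun x => ‖(f ∘ σ) x‖ ^ 2 * delta b c τ x) =
      (fun x => ‖f x‖ ^ 2 * delta b c τ (σ.symm x)) ∘ σ := by
    ext x
    simp
  constructor
  · rw [mem_l2_iff, h2]
    exact (Equiv.summable_iff σ).2 h1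
  · rw [sqNorm, h2, sqNorm, ← tsum_mul_left]
    refine (Equiv.tsum_eq σ _).trans_le (h1.tsum_le_tsum (fun x => ?_) (Summable.mul_left K hf))
    nlinarith [mul_le_mul_of_nonneg_left (hσ x) (sq_nonneg ‖f x‖)]

end HilbertSpace

/-! ### Unitarity of the difference-reflection representation -/

section Unitarity

variable {ι V N : Type*} [Fintype ι] [AddCommGroup V] [Module ℝ V] [AddCommGroup N] [Module ℝ N]
  {P : RootPairing ι ℝ V N} [P.IsRootSystem] [P.IsCrystallographic] [P.IsReduced]
  [P.IsIrreducible] {b : P.Base} {ϑ : ι} {c : ℕ} {τ : extAffineWeyl P c → ℝ}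

/-- The detailed balance equation behind the symmetry of `T̂_j`. -/
theorem chi_mul_delta_smul (hϑ : IsHighestShortRoot b ϑ) (hc : 0 < c)
    (hτ : IsLengthMultiplicative b c τ) (j : Option b.support) (x : weightLattice P) :
    chi (τ (simpleRefl b ϑ c j)) (-simpleRoot b ϑ c j (x : V)) *
        delta b c τ (simpleRefl b ϑ c j • x) =
      chi (τ (simpleRefl b ϑ c j)) (simpleRoot b ϑ c j (x : V)) * delta b c τ x := by
  have h0 := hτ.ne_zero (simpleRefl b ϑ c j)
  rcases lt_trichotomy (simpleRoot b ϑ c j (x : V)) 0 with h | h | h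
  · have h1 := delta_simpleRefl hϑ hc hτ (x := simpleRefl b ϑ c j • x)
      (by rw [simpleRoot_smul]; linarith)
    rw [simpleRefl_smul_smul] at h1
    rw [chi_of_pos (by linarith), chi_of_neg h, h1]
    field_simp
  · rw [simpleRefl_smul_of_eq_zero h, h, neg_zero]
  · rw [chi_of_neg (by linarith), chi_of_pos h, delta_simpleRefl hϑ hc hτ h]
    field_simp

theorem delta_smul_le (hϑ : IsHighestShortRoot b ϑ) (hc : 0 < c)
    (hτ : IsLengthMultiplicative b c τ) (j : Option b.support) (x : weightLattice P) :
    delta b c τ (simpleRefl b ϑ c j • x) ≤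
      (τ (simpleRefl b ϑ c j) ^ 2 + 1 + (τ (simpleRefl b ϑ c j))⁻¹ ^ 2) * delta b c τ x := by
  have hδ := delta_nonneg b c τ x
  have h0 := hτ.ne_zero (simpleRefl b ϑ c j)
  have h1 := mul_nonneg (sq_nonneg (τ (simpleRefl b ϑ c j))) hδ
  have h2 := mul_nonneg (sq_nonneg (τ (simpleRefl b ϑ c j))⁻¹) hδ
  rcases lt_trichotomy (simpleRoot b ϑ c j (x : V)) 0 with h | h | h
  · have h3 := delta_simpleRefl hϑ hc hτ (x := simpleRefl b ϑ c j • x)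
      (by rw [simpleRoot_smul]; linarith)
    rw [simpleRefl_smul_smul] at h3
    have h4 : (τ (simpleRefl b ϑ c j))⁻¹ ^ 2 * delta b c τ x =
        delta b c τ (simpleRefl b ϑ c j • x) := by
      rw [h3]
      field_simp
    linarith
  · rw [simpleRefl_smul_of_eq_zero h]
    linarith
  · rw [delta_simpleRefl hϑ hc hτ h]
    linarith

theorem abs_chi_le (t y : ℝ) : |chi t y| ≤ |t| + 1 + |t⁻¹| := by
  have h1 := abs_nonneg t
  have h2 := abs_nonneg t⁻¹
  unfold chi
  split_ifs
  · linarith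
  · rw [abs_one]; linarith
  · linarith

theorem comp_simpleRefl_mem_l2 (hϑ : IsHighestShortRoot b ϑ) (hc : 0 < c)
    (hτ : IsLengthMultiplicative b c τ) (j : Option b.support) {f : weightLattice P → ℂ}
    (hf : f ∈ l2 b c τ) :
    (fun x => f (simpleRefl b ϑ c j • x)) ∈ l2 b c τ ∧
      sqNorm b c τ (fun x => f (simpleRefl b ϑ c j • x)) ≤
        (τ (simpleRefl b ϑ c j) ^ 2 + 1 + (τ (simpleRefl b ϑ c j))⁻¹ ^ 2) * sqNorm b c τ f := by
  refine sqNorm_comp_le (σ := MulAction.toPerm (simpleRefl b ϑ c j)) (fun x => ?_) hf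
  rw [MulAction.toPerm_symm_apply, simpleRefl_inv]
  exact delta_smul_le hϑ hc hτ j x

theorem isBoundedOn_diffRefl (hϑ : IsHighestShortRoot b ϑ) (hc : 0 < c)
    (hτ : IsLengthMultiplicative b c τ) (j : Option b.support) :
    IsBoundedOn b c τ (diffRefl b ϑ c τ j) := by
  set t := τ (simpleRefl b ϑ c j) with ht
  set M := |t| + 1 + |t⁻¹| with hM
  have hM0 : 0 ≤ M := by positivity
  refine ⟨8 * M ^ 2 * (1 + (t ^ 2 + 1 + t⁻¹ ^ 2)), by positivity, fun f hf => ?_⟩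
  obtain ⟨h1, h2⟩ := comp_simpleRefl_mem_l2 hϑ hc hτ j hf
  have hpt : ∀ x, ‖diffRefl b ϑ c τ j f x‖ ^ 2 * delta b c τ x ≤
      8 * M ^ 2 * (‖f x‖ ^ 2 * delta b c τ x +
        ‖f (simpleRefl b ϑ c j • x)‖ ^ 2 * delta b c τ x) := fun x => by
    have h3 : ‖diffRefl b ϑ c τ j f x‖ ≤
        2 * M * (‖f x‖ + ‖f (simpleRefl b ϑ c j • x)‖) := by
      rw [diffRefl_apply]
      have h4 := abs_chi_le t (simpleRoot b ϑ c j (x : V))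
      have h5 : |t| ≤ M := by
        have := abs_nonneg t⁻¹
        linarith
      refine (norm_add_le _ _).trans ?_
      rw [norm_mul, norm_mul, Complex.norm_real, Complex.norm_real, Real.norm_eq_abs,
        Real.norm_eq_abs]
      have h6 := norm_sub_le (f (simpleRefl b ϑ c j • x)) (f x)
      have h7 := mul_le_mul h4 h6 (norm_nonneg _) hM0
      have h8 := mul_le_mul_of_nonneg_right h5 (norm_nonneg (f x))
      have h9 := mul_nonneg hM0 (norm_nonneg (f (simpleRefl b ϑ c j • x)))
      linarith
    rw [← add_mul, ← mul_assoc]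
    refine mul_le_mul_of_nonneg_right ?_ (delta_nonneg b c τ x)
    refine (pow_le_pow_left₀ (norm_nonneg _) h3 2).trans ?_
    nlinarith [sq_nonneg M, mul_nonneg (sq_nonneg M)
      (sq_nonneg (‖f x‖ - ‖f (simpleRefl b ϑ c j • x)‖))]
  have hsum : Summable fun x => 8 * M ^ 2 * (‖f x‖ ^ 2 * delta b c τ x +
      ‖f (simpleRefl b ϑ c j • x)‖ ^ 2 * delta b c τ x) :=
    Summable.mul_left _ (Summable.add hf h1)
  have hmem : diffRefl b ϑ c τ j f ∈ l2 b c τ := Summable.of_nonneg_of_le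
    (fun x => mul_nonneg (sq_nonneg _) (delta_nonneg b c τ x)) hpt hsum
  refine ⟨hmem, (Summable.tsum_le_tsum hpt hmem hsum).trans ?_⟩
  rw [tsum_mul_left, Summable.tsum_add hf h1, mul_assoc (8 * M ^ 2), add_mul, one_mul]
  exact mul_le_mul_of_nonneg_left (add_le_add le_rfl h2) (by positivity)

theorem isBoundedOn_actOp (hϑ : IsHighestShortRoot b ϑ) (hc : 0 < c)
    (hτ : IsLengthMultiplicative b c τ) {u : extAffineWeyl P c} (hu : length b c u = 0) :
    IsBoundedOn b c τ (actOp c u) := by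
  refine ⟨1, zero_le_one, fun f hf => ?_⟩
  refine sqNorm_comp_le (σ := MulAction.toPerm u⁻¹) (fun x => ?_) hf
  rw [MulAction.toPerm_symm_apply, inv_inv, delta_of_length_eq_zero hϑ hc hτ hu, one_mul]

theorem isBoundedOn_of_isDiffReflRep (hϑ : IsHighestShortRoot b ϑ) (hc : 0 < c)
    (hτ : IsLengthMultiplicative b c τ)
    {ρ : HeckeAlgebra b ϑ c τ →ₐ[ℂ] Module.End ℂ (weightLattice P → ℂ)}
    (hρ : IsDiffReflRep b ϑ c τ ρ) (h : HeckeAlgebra b ϑ c τ) : IsBoundedOn b c τ (ρ h) := by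
  induction h using hϑ.hecke_induction hc with
  | scalar z =>
    rw [AlgHom.commutes]
    exact isBoundedOn_algebraMap z
  | simple j =>
    rw [hρ.simple]
    exact isBoundedOn_diffRefl hϑ hc hτ j
  | omega u hu =>
    rw [hρ.omega u hu]
    exact isBoundedOn_actOp hϑ hc hτ hu
  | mul x y hx hy =>
    rw [map_mul]
    exact hx.mul hy
  | add x y hx hy =>
    rw [map_add]
    exact hx.add hy

theorem innerDelta_diffRefl (hϑ : IsHighestShortRoot b ϑ) (hc : 0 < c)
    (hτ : IsLengthMultiplicative b c τ) (j : Option b.support) {f g : weightLattice P → ℂ}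
    (hf : f ∈ l2 b c τ) (hg : g ∈ l2 b c τ) :
    innerDelta b c τ (diffRefl b ϑ c τ j f) g = innerDelta b c τ f (diffRefl b ϑ c τ j g) := by
  set t := τ (simpleRefl b ϑ c j) with ht
  -- The off-diagonal parts of the two sides, which are matched by the substitution `x ↦ s_j x`.
  set F : weightLattice P → ℂ := fun x => (chi t (simpleRoot b ϑ c j (x : V)) : ℂ) *
    f (simpleRefl b ϑ c j • x) * conj (g x) * (delta b c τ x : ℂ) with hF
  set G : weightLattice P → ℂ := fun x => (chi t (simpleRoot b ϑ c j (x : V)) : ℂ) *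
    f x * conj (g (simpleRefl b ϑ c j • x)) * (delta b c τ x : ℂ) with hG
  have hFG : F ∘ MulAction.toPerm (simpleRefl b ϑ c j) = G := by
    ext x
    have h1 := congrArg (fun y : ℝ => (y : ℂ)) (chi_mul_delta_smul hϑ hc hτ j x)
    simp only [Complex.ofReal_mul, ← ht] at h1
    simp only [hF, hG, Function.comp_apply, MulAction.toPerm_apply, simpleRoot_smul,
      simpleRefl_smul_smul]
    linear_combination (f x * conj (g (simpleRefl b ϑ c j • x))) * h1
  have hbdd : ∀ {f g : weightLattice P → ℂ}, f ∈ l2 b c τ → g ∈ l2 b c τ →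
      ∀ m : weightLattice P → ℝ, (∀ x, |m x| ≤ 2 * (|t| + 1 + |t⁻¹|)) →
        Summable fun x => (m x : ℂ) * (f x * conj (g x) * (delta b c τ x : ℂ)) := by
    intro f g hf hg m hm
    refine Summable.of_norm_bounded
      ((summable_inner hf hg).norm.mul_left (2 * (|t| + 1 + |t⁻¹|))) fun x => ?_
    rw [norm_mul, Complex.norm_real, Real.norm_eq_abs]
    exact mul_le_mul_of_nonneg_right (hm x) (norm_nonneg _)
  have hchi : ∀ x : weightLattice P,
      |chi t (simpleRoot b ϑ c j (x : V))| ≤ 2 * (|t| + 1 + |t⁻¹|) := fun x => by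
    have h1 := abs_chi_le t (simpleRoot b ϑ c j (x : V))
    have h2 := abs_nonneg (chi t (simpleRoot b ϑ c j (x : V)))
    linarith
  have hdiag : ∀ x : weightLattice P,
      |t - chi t (simpleRoot b ϑ c j (x : V))| ≤ 2 * (|t| + 1 + |t⁻¹|) := fun x => by
    have h1 := abs_chi_le t (simpleRoot b ϑ c j (x : V))
    have h2 := abs_sub t (chi t (simpleRoot b ϑ c j (x : V)))
    have h3 := abs_nonneg t⁻¹
    linarith
  have hD := hbdd hf hg _ hdiag
  have hFs : Summable F := (hbdd (comp_simpleRefl_mem_l2 hϑ hc hτ j hf).1 hg _ hchi).congr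
    fun x => by simp only [hF]; ring
  have hGs : Summable G := (hbdd hf (comp_simpleRefl_mem_l2 hϑ hc hτ j hg).1 _ hchi).congr
    fun x => by simp only [hG]; ring
  have hl : innerDelta b c τ (diffRefl b ϑ c τ j f) g =
      (∑' x : weightLattice P, ((t - chi t (simpleRoot b ϑ c j (x : V)) : ℝ) : ℂ) *
        (f x * conj (g x) * (delta b c τ x : ℂ))) + ∑' x, F x := by
    rw [← hD.tsum_add hFs, innerDelta]
    refine tsum_congr fun x => ?_
    rw [diffRefl_apply]
    simp only [hF]
    push_cast
    ring
  have hr : innerDelta b c τ f (diffRefl b ϑ c τ j g) =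
      (∑' x : weightLattice P, ((t - chi t (simpleRoot b ϑ c j (x : V)) : ℝ) : ℂ) *
        (f x * conj (g x) * (delta b c τ x : ℂ))) + ∑' x, G x := by
    rw [← hD.tsum_add hGs, innerDelta]
    refine tsum_congr fun x => ?_
    rw [diffRefl_apply]
    simp only [hG, map_add, map_mul, map_sub, Complex.conj_ofReal]
    push_cast
    ring
  rw [hl, hr, ← hFG]
  congr 1
  exact (Equiv.tsum_eq (MulAction.toPerm (simpleRefl b ϑ c j)) F).symm

theorem innerDelta_actOp (hϑ : IsHighestShortRoot b ϑ) (hc : 0 < c)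
    (hτ : IsLengthMultiplicative b c τ) {u : extAffineWeyl P c} (hu : length b c u = 0)
    (f g : weightLattice P → ℂ) :
    innerDelta b c τ (actOp c u f) g = innerDelta b c τ f (actOp c u⁻¹ g) := by
  rw [innerDelta, innerDelta, ← Equiv.tsum_eq (MulAction.toPerm u)]
  refine tsum_congr fun x => ?_
  change f (u⁻¹ • u • x) * conj (g (u • x)) * (delta b c τ (u • x) : ℂ) =
    f x * conj (g (u⁻¹⁻¹ • x)) * (delta b c τ x : ℂ)
  rw [inv_smul_smul, inv_inv, delta_of_length_eq_zero hϑ hc hτ hu]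

theorem innerDelta_of_isDiffReflRep (hϑ : IsHighestShortRoot b ϑ) (hc : 0 < c)
    (hτ : IsLengthMultiplicative b c τ)
    {ρ : HeckeAlgebra b ϑ c τ →ₐ[ℂ] Module.End ℂ (weightLattice P → ℂ)}
    (hρ : IsDiffReflRep b ϑ c τ ρ) (h : HeckeAlgebra b ϑ c τ) :
    ∀ f ∈ l2 b c τ, ∀ g ∈ l2 b c τ,
      innerDelta b c τ (ρ h f) g = innerDelta b c τ f (ρ (star h) g) := by
  have hmem : ∀ h, ∀ f ∈ l2 b c τ, ρ h f ∈ l2 b c τ := fun h f hf =>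
    ((isBoundedOn_of_isDiffReflRep hϑ hc hτ hρ h).choose_spec.2 f hf).1
  induction h using hϑ.hecke_induction hc with
  | scalar z =>
    intro f _ g _
    rw [← algebraMap_star_comm, AlgHom.commutes, AlgHom.commutes, innerDelta, innerDelta]
    refine tsum_congr fun x => ?_
    simp only [Module.algebraMap_end_apply, Pi.smul_apply, smul_eq_mul, map_mul, RCLike.star_def,
      Complex.conj_conj]
    ring
  | simple j =>
    intro f hf g hg
    rw [star_heckeT, simpleRefl_inv, hρ.simple]
    exact innerDelta_diffRefl hϑ hc hτ j hf hg
  | omega u hu =>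
    intro f _ g _
    have hu' : length b c (u⁻¹ : extAffineWeyl P c) = 0 := by
      rw [Subgroup.coe_inv, length_inv, hu]
    rw [star_heckeT, hρ.omega u hu, hρ.omega _ hu']
    exact innerDelta_actOp hϑ hc hτ hu f g
  | mul x y hx hy =>
    intro f hf g hg
    rw [star_mul, map_mul, map_mul, Module.End.mul_apply, Module.End.mul_apply,
      hx _ (hmem y f hf) g hg, hy f hf _ (hmem _ g hg)]
  | add x y hx hy =>
    intro f hf g hg
    rw [star_add, map_add, map_add, LinearMap.add_apply, LinearMap.add_apply,
      innerDelta_add_left (hmem x f hf) (hmem y f hf) hg,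
      innerDelta_add_right hf (hmem _ g hg) (hmem _ g hg), hx f hf g hg, hy f hf g hg]

end Unitarity

/-! ### Convergence of the Poincaré series -/

theorem summable_prod_pow_natAbs (κ : Type*) [Fintype κ] {q : ℝ} (hq0 : 0 ≤ q) (hq1 : q < 1) :
    Summable fun m : κ → ℤ => ∏ k, q ^ (m k).natAbs := by
  classical
  have h1 : Summable fun m : ℤ => q ^ m.natAbs :=
    Summable.of_nat_of_neg (by simpa using summable_geometric_of_lt_one hq0 hq1)
      (by simpa using summable_geometric_of_lt_one hq0 hq1)
  refine summable_of_sum_le (c := ∏ _k : κ, ∑' m : ℤ, q ^ m.natAbs)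
    (fun m => Finset.prod_nonneg fun k _ => pow_nonneg hq0 _) fun s => ?_
  have hs : s ⊆ Fintype.piFinset fun k => s.image fun m => m k := fun m hm =>
    Fintype.mem_piFinset.2 fun k => Finset.mem_image_of_mem _ hm
  refine (Finset.sum_le_sum_of_subset_of_nonneg hs fun m _ _ =>
    Finset.prod_nonneg fun k _ => pow_nonneg hq0 _).trans ?_
  rw [← Finset.prod_univ_sum (fun k => s.image fun m => m k) fun _ m => q ^ m.natAbs]
  exact Finset.prod_le_prod (fun k _ => Finset.sum_nonneg fun m _ => pow_nonneg hq0 _)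
    fun k _ => h1.sum_le_tsum _ fun m _ => pow_nonneg hq0 _

theorem summable_comp_snd (α : Type*) {β : Type*} [Finite α] {f : β → ℝ} (hf0 : ∀ x, 0 ≤ f x)
    (hf : Summable f) : Summable fun x : α × β => f x.2 := by
  refine (Summable.mul_of_nonneg (f := fun _ : α => (1 : ℝ)) Summable.of_finite hf
    (fun _ => zero_le_one) hf0).congr fun x => one_mul _

section Poincare

variable {ι V N : Type*} [Fintype ι] [AddCommGroup V] [Module ℝ V] [AddCommGroup N] [Module ℝ N]
  {P : RootPairing ι ℝ V N} [P.IsRootSystem] [P.IsCrystallographic] {b : P.Base} {ϑ : ι}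
  {c : ℕ} {τ : extAffineWeyl P c → ℝ}

theorem coroot'_apply_zero (w : extAffineWeyl P c) (i : ι) :
    ∃ n : ℤ, P.coroot' i ((w : V ≃ᵃ[ℝ] V) 0) = n * c := by
  obtain ⟨i', r', h, -⟩ := exists_affRoot_comp P w.2 i 0
  have h0 := congrFun h 0
  simp only [Function.comp_apply, affRoot, map_zero, Int.cast_zero, zero_mul, add_zero,
    zero_add] at h0
  exact ⟨r', h0⟩

/-- If `w` moves the origin across the hyperplanes `α_i^∨ + r c = 0` with `0 < r < n`, then all of
these contribute to the length. -/
theorem le_length_add_one (b : P.Base) (hc : 0 < c) (w : extAffineWeyl P c) (i : ι) (n : ℕ)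
    (hn : P.coroot' i ((w : V ≃ᵃ[ℝ] V) 0) = -(n : ℝ) * c) : n ≤ length b c w + 1 := by
  have hc' : (0 : ℝ) < c := by exact_mod_cast hc
  have hsub : (fun r : ℕ => affRoot P c i (r + 1)) '' (Finset.range (n - 1) : Set ℕ) ⊆
      inversions b c (w⁻¹ : extAffineWeyl P c) := by
    rintro _ ⟨r, hr, rfl⟩
    refine ⟨Or.inr ⟨i, _, by omega, rfl⟩, ?_⟩
    obtain ⟨i', r', h, -⟩ := exists_affRoot_comp P w.2 i (r + 1)
    change -(affRoot P c i (r + 1) ∘ (w : V ≃ᵃ[ℝ] V)) ∈ _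
    have h0 := congrFun h 0
    simp only [Function.comp_apply, affRoot, map_zero, zero_add, hn] at h0
    have h1 : (-(n : ℝ) + (r + 1 : ℤ)) = r' := by
      refine mul_right_cancel₀ hc'.ne' ?_
      linarith
    have h2 : -(n : ℤ) + (r + 1) = r' := by exact_mod_cast h1
    have h3 : r < n - 1 := by simpa using hr
    rw [h, neg_affRoot]
    exact Or.inr ⟨_, _, by omega, rfl⟩
  have hinj : Function.Injective fun r : ℕ => affRoot P c i (r + 1) := by
    intro r r' h
    have h0 := congrFun h 0
    simp only [affRoot, map_zero, zero_add] at h0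
    have h1 := mul_right_cancel₀ hc'.ne' h0
    push_cast at h1
    exact_mod_cast add_right_cancel h1
  have hcard := Set.ncard_le_ncard hsub (finite_inversions hc _)
  rw [Set.ncard_image_of_injective _ hinj, Set.ncard_coe_finset, Finset.card_range] at hcard
  have hlen : (inversions b c (w⁻¹ : extAffineWeyl P c)).ncard = length b c w := by
    rw [← length_inv]
    rfl
  omega

/-- An element of `W` is determined by its linear part, encoded as the induced map on the finite set
of roots, and the image of the origin, encoded by its coroot coordinates in units of `c`. -/
theorem exists_injective_coordinates (b : P.Base) (hc : 0 < c) :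
    ∃ φ : extAffineWeyl P c → (ι → ι) × (ι → ℤ), Function.Injective φ ∧
      ∀ w i, ((φ w).2 i).natAbs ≤ length b c w + 1 := by
  have h1 : ∀ (w : extAffineWeyl P c) (i : ι), ∃ i',
      (w : V ≃ᵃ[ℝ] V).linear (P.root i') = P.root i := fun w i => by
    obtain ⟨i', -, -, h⟩ := exists_affRoot_comp P w.2 i 0
    exact ⟨i', h⟩
  choose σ hσ using h1
  choose m hm using fun w : extAffineWeyl P c => coroot'_apply_zero w
  refine ⟨fun w => (σ w, m w), fun w w' h => ?_, fun w i => ?_⟩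
  · simp only [Prod.mk.injEq] at h
    have hσw : Function.Surjective (σ w) := Finite.surjective_of_injective fun i i' hii => by
      have := hσ w i
      rw [hii, hσ w i'] at this
      exact (P.root.injective this).symm
    have hlin : ((w : V ≃ᵃ[ℝ] V).linear : V →ₗ[ℝ] V) = (w' : V ≃ᵃ[ℝ] V).linear := by
      refine LinearMap.ext_on_range (v := P.root)
        (RootPairing.IsRootSystem.span_root_eq_top (P := P)) fun k => ?_
      obtain ⟨i, rfl⟩ := hσw k
      change (w : V ≃ᵃ[ℝ] V).linear _ = (w' : V ≃ᵃ[ℝ] V).linear _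
      rw [hσ w i, h.1, hσ w' i]
    have hzero : (w : V ≃ᵃ[ℝ] V) 0 = (w' : V ≃ᵃ[ℝ] V) 0 := by
      rw [← sub_eq_zero, P.eq_zero_iff_forall_coroot'_eq_zero]
      intro i
      rw [map_sub, hm w i, hm w' i, h.2, sub_self]
    have happ : ∀ (v : extAffineWeyl P c) x,
        (v : V ≃ᵃ[ℝ] V) x = (v : V ≃ᵃ[ℝ] V).linear x + (v : V ≃ᵃ[ℝ] V) 0 := fun v x => by
      have := (v : V ≃ᵃ[ℝ] V).map_vadd 0 x
      simpa using this
    ext x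
    rw [happ w, happ w', hzero]
    exact congrArg (· + _) (LinearMap.congr_fun hlin x)
  · rcases le_total 0 (m w i) with h | h
    · refine le_length_add_one b hc w (P.reflectionPerm i i) _ ?_
      rw [coroot'_reflectionPerm_self, hm w i]
      have h2 : (((m w i).natAbs : ℤ) : ℝ) = m w i := by rw [Int.natAbs_of_nonneg h]
      rw [Int.cast_natCast] at h2
      rw [h2, neg_mul]
    · refine le_length_add_one b hc w i _ ?_
      rw [hm w i]
      have h2 : (((m w i).natAbs : ℤ) : ℝ) = (-m w i : ℤ) := by rw [Int.ofNat_natAbs_of_nonpos h]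
      rw [Int.cast_natCast, Int.cast_neg] at h2
      rw [h2, neg_neg]

/-- The lengths in `W` grow at least linearly with the displacement of the origin, so the number of
elements of given length grows only polynomially. -/
theorem summable_pow_length (b : P.Base) (hc : 0 < c) [Nonempty ι] {q : ℝ} (hq0 : 0 < q)
    (hq1 : q < 1) : Summable fun w : extAffineWeyl P c => q ^ length b c w := by
  obtain ⟨φ, hφ, hlen⟩ := exists_injective_coordinates b hc
  -- A root of `q`, as the displacement only has as many coordinates as there are roots.
  obtain ⟨r, hr0, hr1, hrn⟩ : ∃ r : ℝ, 0 < r ∧ r < 1 ∧ r ^ Fintype.card ι = q :=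
    ⟨q ^ ((Fintype.card ι : ℝ)⁻¹), Real.rpow_pos_of_pos hq0 _,
      Real.rpow_lt_one hq0.le hq1 (inv_pos.2 (Nat.cast_pos.2 Fintype.card_pos)),
      Real.rpow_inv_natCast_pow hq0.le Fintype.card_ne_zero⟩
  have hsum := summable_comp_snd (ι → ι)
    (fun m => Finset.prod_nonneg fun k _ => pow_nonneg hr0.le _)
    (summable_prod_pow_natAbs ι hr0.le hr1)
  have hle : ∀ w : extAffineWeyl P c,
      q ^ length b c w ≤ q⁻¹ * ∏ k, r ^ ((φ w).2 k).natAbs := fun w => by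
    rw [Finset.prod_pow_eq_pow_sum, inv_mul_eq_div, le_div_iff₀ hq0, ← pow_succ, ← hrn,
      ← pow_mul]
    refine pow_le_pow_of_le_one hr0.le hr1.le ?_
    calc ∑ k, ((φ w).2 k).natAbs ≤ ∑ _k : ι, (length b c w + 1) :=
          Finset.sum_le_sum fun k _ => hlen w k
      _ = Fintype.card ι * (length b c w + 1) := by
        rw [Finset.sum_const, smul_eq_mul, Finset.card_univ]
  exact Summable.of_nonneg_of_le (fun w => pow_nonneg hq0.le _) hle
    ((hsum.comp_injective hφ).mul_left q⁻¹)

theorem IsHighestShortRoot.summable_tau_sq [P.IsReduced] [P.IsIrreducible]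
    (hϑ : IsHighestShortRoot b ϑ) (hc : 0 < c) (hτ : IsLengthMultiplicative b c τ)
    (hτ1 : ∀ j, 0 < τ (simpleRefl b ϑ c j) ^ 2 ∧ τ (simpleRefl b ϑ c j) ^ 2 < 1) :
    Summable fun w => τ w ^ 2 := by
  have hS := hϑ.isLengthSystem hc
  obtain ⟨j₀, hj₀⟩ := Finite.exists_max fun j => τ (simpleRefl b ϑ c j) ^ 2
  have : Nonempty ι := ⟨ϑ⟩
  refine Summable.of_nonneg_of_le (fun w => sq_nonneg _) (fun w => ?_)
    (summable_pow_length b hc (hτ1 j₀).1 (hτ1 j₀).2)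
  induction w using hS.induction with
  | zero u hu => rw [hτ.map_length_zero u hu, hu, one_pow, pow_zero]
  | simple_mul j w hw ih =>
    have h1 : length b c (simpleRefl b ϑ c j) = 1 := hS.length_simple j
    rw [hτ.map_mul _ _ (by rw [hw, h1, add_comm]), hw, mul_pow, mul_comm,
      pow_succ (τ (simpleRefl b ϑ c j₀) ^ 2)]
    exact mul_le_mul ih (hj₀ j) (sq_nonneg _) (pow_nonneg (hτ1 j₀).1.le _)

end Poincare

end CriticalHecke

theorem proposition8p1 {ι V N : Type*} [Fintype ι] [AddCommGroup V] [Module ℝ V]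
    [AddCommGroup N] [Module ℝ N] (P : RootPairing ι ℝ V N) [P.IsRootSystem]
    [P.IsCrystallographic] [P.IsReduced] [P.IsIrreducible] (b : P.Base) (ϑ : ι)
    (hϑ : CriticalHecke.IsHighestShortRoot b ϑ) (c : ℕ) (hc : 1 < c)
    (τ : CriticalHecke.extAffineWeyl P c → ℝ)
    (hτ : CriticalHecke.IsLengthMultiplicative b c τ)
    (hτ1 : ∀ j, 0 < τ (CriticalHecke.simpleRefl b ϑ c j) ^ 2 ∧
      τ (CriticalHecke.simpleRefl b ϑ c j) ^ 2 < 1) :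
    (Summable fun w : CriticalHecke.affinePart P c => τ w ^ 2) ∧
    (∀ x, 0 < CriticalHecke.delta b c τ x) ∧
    ∃ ρ : CriticalHecke.HeckeAlgebra b ϑ c τ →ₐ[ℂ]
        Module.End ℂ (CriticalHecke.weightLattice P → ℂ),
      CriticalHecke.IsDiffReflRep b ϑ c τ ρ ∧
      (∀ ρ', CriticalHecke.IsDiffReflRep b ϑ c τ ρ' → ρ' = ρ) ∧
      (∀ h, ∃ C : ℝ, ∀ f ∈ CriticalHecke.l2 b c τ, ρ h f ∈ CriticalHecke.l2 b c τ ∧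
        CriticalHecke.normDelta b c τ (ρ h f) ≤ C * CriticalHecke.normDelta b c τ f) ∧
      (∀ h, ∀ f ∈ CriticalHecke.l2 b c τ, ∀ g ∈ CriticalHecke.l2 b c τ,
        CriticalHecke.innerDelta b c τ (ρ h f) g =
          CriticalHecke.innerDelta b c τ f (ρ (star h) g)) := by
  have hc0 : 0 < c := by omega
  have hsum : Summable fun w : CriticalHecke.affinePart P c => τ w ^ 2 :=
    (hϑ.summable_tau_sq hc0 hτ hτ1).subtype _
  have hpos : ∀ w, 0 < τ w ^ 2 := fun w => by have := hτ.ne_zero w; positivity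
  obtain ⟨ρ, hρ⟩ := hϑ.exists_isDiffReflRep hc0 hτ
  refine ⟨hsum, fun x => ?_, ρ, hρ, fun ρ' hρ' => hϑ.isDiffReflRep_unique hc0 hρ hρ',
    fun h => (CriticalHecke.isBoundedOn_of_isDiffReflRep hϑ hc0 hτ hρ h).exists_normDelta_le,
    CriticalHecke.innerDelta_of_isDiffReflRep hϑ hc0 hτ hρ⟩
  have hone : (1 : CriticalHecke.extAffineWeyl P c) ∈ CriticalHecke.affinePart P c :=
    one_mem (CriticalHecke.affineWeyl P c)
  exact mul_pos (inv_pos.2 (hsum.tsum_pos (fun w => sq_nonneg _) ⟨1, hone⟩ (hpos 1))) (hpos _)
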